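/- Let $A\in\mathbb Z^{m\times n}$ with $n\ge 1$ have full row rank $m$, and let $b\in\mathbb Z^m$. Let $P=P(A,b)=\{x\in\mathbb R^n : Ax=b,\ -x\le 0\}$, and let $\Delta_A$ be the maximum of $|\det B|$ over all $m\times m$ submatrices $B$ of $A$. Let $r>0$ be such that $\|x\|<r$ for all $x\in P$, and suppose that $P$ is either empty or contains a point $\bar x$ with $\bar x_i>0$ for all $i$. The LFS algorithm receives $A,b,\Delta_A,r$. It runs Chubanov's divide and conquer (D&C) algorithm once, on the system $Ax-bt=0,\ -x\le -\mathbf 1,\ -t\le -2$ with center $z=0$, radius $\hat r=2n\Delta_A\sqrt{r^2+1}$ and $\epsilon=1$. If that run returns $(x^*,t^*)$, the LFS algorithm returns $x^*/t^*$; if it fails or returns a separating hyperplane, the LFS algorithm declares $Ax=b,\ x\ge 0$ infeasible. Here the D&C algorithm for a system $Ax=b,\ Cx\le d$ (with rows $c_k$ of $C$, and $\|c_{\max}\|=\max_k\|c_k\|$) and a triple $(z,r,\epsilon)$ is the following recursion, in exact real arithmetic. * If $r\le \epsilon/(2\|c_{\max}\|)$, let $p$ be the projection of $z$ onto $\{x: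 Ax=b\}$. If $\|p-z\|<r$ and $(c_kz-d_k)/\|c_k\|<r$ for all $k$, return the point $p$; if $\|p-z\|\ge r$, return the hyperplane $hx=\delta$ with $h=z-p$, $\delta=h\cdot p$; otherwise return $c_kx=d_k$ for some $k$ with $(c_kz-d_k)/\|c_k\|\ge r$. * Otherwise run D&C on $(z,\tfrac57 r,\epsilon)$. If this yields a hyperplane $h_1x=\delta_1$, let $z_0$ be the projection of $z$ onto it and run D&C on $(z_0,\tfrac57 r,\epsilon)$. A point, or failure, in either call is passed on. If the second call yields $h_2x=\delta_2$, fail if $h_1=-\gamma h_2$ for some $\gamma>0$; otherwise return $hx=\delta$ with $h=\alpha h_1+(1-\alpha)h_2$, $\delta=\alpha\delta_1+(1-\alpha)\delta_2$, where $\alpha\in[0,1]$ is such that $(hz-\delta)/\|h\|\ge r$. (The choice made is $\alpha=\lambda_1/(\lambda_1+\lambda_2)$ with $\lambda_1=(h_1z-\delta_1)/\|h_1\|^2$ and $\lambda_2=(h_2z_0-\delta_2)/\|h_2\|^2$.) Theorem. The LFS algorithm terminates and is correct: either it returns a point of $P$, or it declares the system infeasible and then $P=\emptyset$. The number of arithmetic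 operations and comparisons that it performs is $$O\Big(m^3+m^2n+n^2m+\big(2n\Delta_A\sqrt{r^2+1}\big)^{\frac1{\log_2(7/5)}}\big(n^2+n\max\{0,\log\Delta_A+\log r\}\big)\Big)$$ with an absolute implied constant. (If $P\ne\emptyset$, or if $r\ge 1$, then $\log\Delta_A+\log r\ge 0$ and the maximum is $\log\Delta_A+\log r$.) -/

import Mathlib

/-! ## Programs over an abstract number type, counted in arithmetic operations

A program is an algebraic computation tree. Every definition of an algorithm below is written for an
arbitrary type `K` that carries no algebraic structure, so the constructors `lit`, `op` and `lt` are
the only way in which an algorithm can load a constant, calculate with numbers, or compare them. -/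

/-- The four arithmetic operations. -/
inductive ArithOp : Type
  | add | sub | mul | div

/-- The value of an arithmetic operation; division by zero is undefined. -/
def ArithOp.eval {K : Type} [Field K] [LinearOrder K] : ArithOp → K → K → Option K
  | .add, x, y => some (x + y)
  | .sub, x, y => some (x - y)
  | .mul, x, y => some (x * y)
  | .div, x, y => if y = 0 then none else some (x / y)

/-- Programs with numbers in `K` and a result in `α`. -/
inductive Prog (K : Type) (α : Type) : Type
  /-- stop with a result -/
  | ret : α → Prog K α
  /-- load the constant `k` -/
  | lit : ℕ → (K → Prog K α) → Prog K α
  /-- carry out one arithmetic operation and go on with its value -/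
  | op : ArithOp → K → K → (K → Prog K α) → Prog K α
  /-- find out whether `x < y` and branch -/
  | lt : K → K → (Bool → Prog K α) → Prog K α
  /-- no result: the bound on the depth of the recursion was too small -/
  | outOfFuel : Prog K α

namespace Prog

variable {K α β : Type}

/-- Run a program, then a second one that depends on its result. -/
def bind : Prog K α → (α → Prog K β) → Prog K β
  | ret a, g => g a
  | lit k f, g => lit k (fun x => bind (f x) g)
  | op o x y f, g => op o x y (fun v => bind (f v) g)
  | lt x y f, g => lt x y (fun t => bind (f t) g)
  | outOfFuel, _ => outOfFuel

instance : Monad (Prog K) where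
  pure := ret
  bind := bind

/-- The result of a program together with the number of arithmetic operations, comparisons and loaded
constants on the way to it; `none` if it divides by zero or runs out of fuel. -/
def run [Field K] [LinearOrder K] : Prog K α → Option (α × ℕ)
  | ret a => some (a, 0)
  | lit k f => (run (f (k : K))).map (fun p => (p.1, p.2 + 1))
  | op o x y f =>
      match o.eval x y with
      | none => none
      | some v => (run (f v)).map (fun p => (p.1, p.2 + 1))
  | lt x y f => (run (f (decide (x < y)))).map (fun p => (p.1, p.2 + 1))
  | outOfFuel => none

/-- The constant `k`. -/
def const (k : ℕ) : Prog K K := lit k ret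
/-- `x + y` -/
def add (x y : K) : Prog K K := op .add x y ret
/-- `x - y` -/
def sub (x y : K) : Prog K K := op .sub x y ret
/-- `x * y` -/
def mul (x y : K) : Prog K K := op .mul x y ret
/-- `x / y` -/
def div (x y : K) : Prog K K := op .div x y ret
/-- the test `x < y` -/
def less (x y : K) : Prog K Bool := lt x y ret

/-- `-x` -/
def neg (x : K) : Prog K K := do
  let zero ← const 0
  sub zero x

/-- Run `n` programs one after the other and collect their results in a vector. -/
def vec : {n : ℕ} → (Fin n → Prog K α) → Prog K (Fin n → α)
  | 0, _ => ret Fin.elim0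
  | _ + 1, f => do
      let a ← f 0
      let v ← vec (fun i => f i.succ)
      return Fin.cons a v

/-- `u · v` -/
def dot : {n : ℕ} → (Fin n → K) → (Fin n → K) → Prog K K
  | 0, _, _ => const 0
  | _ + 1, u, v => do
      let p ← mul (u 0) (v 0)
      let s ← dot (Fin.tail u) (Fin.tail v)
      add p s

/-- `u - v` -/
def vsub {n : ℕ} (u v : Fin n → K) : Prog K (Fin n → K) :=
  vec (fun i => sub (u i) (v i))

/-- `u - c v` -/
def subSmul {n : ℕ} (u : Fin n → K) (c : K) (v : Fin n → K) : Prog K (Fin n → K) :=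
  vec (fun i => do
    let p ← mul c (v i)
    sub (u i) p)

end Prog

namespace Chubanov

open Prog

variable {K : Type}

/-! ## Projection onto the affine space `Ax = b`

The rows of `A` are orthogonalized once and for all. -/

/-- An equation `q · x = rhs`, stored together with `normSq = q · q`. -/
structure Equation (K : Type) (n : ℕ) : Type where
  /-- the left-hand side -/
  q : Fin n → K
  /-- the right-hand side -/
  rhs : K
  /-- the squared norm of the left-hand side -/
  normSq : K

/-- Subtract from the equation `v · x = β` its components along the mutually orthogonal equations in
the list. -/
def reduceEquation {n : ℕ} : List (Equation K n) → (Fin n → K) → K → Prog K (Equation K n)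
  | [], v, β => do
      let s ← dot v v
      return ⟨v, β, s⟩
  | e :: es, v, β => do
      let p ← dot e.q v
      let c ← div p e.normSq
      let v' ← subSmul v c e.q
      let cβ ← mul c e.rhs
      let β' ← sub β cβ
      reduceEquation es v' β'

/-- The Gram-Schmidt process, without normalization, for the rows of `Ax = b`. -/
def orthogonalize {n : ℕ} : {m : ℕ} → List (Equation K n) → (Fin m → Fin n → K) → (Fin m → K) →
    Prog K (List (Equation K n))
  | 0, es, _, _ => ret es
  | _ + 1, es, A, b => do
      let e ← reduceEquation es (A 0) (b 0)
      orthogonalize (e :: es) (Fin.tail A) (Fin.tail b)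

/-- The projection of `z` onto the solution set of mutually orthogonal equations. -/
def project {n : ℕ} : List (Equation K n) → (Fin n → K) → Prog K (Fin n → K)
  | [], z => ret z
  | e :: es, z => do
      let p ← dot e.q z
      let g ← sub p e.rhs
      let c ← div g e.normSq
      let z' ← subSmul z c e.q
      project es z'

/-! ## The divide and conquer algorithm

Radii enter through their squares, and a comparison of two nonnegative numbers that involves norms is
made between their squares; in this way no square root has to be extracted. -/

/-- The outcomes of the divide and conquer algorithm: an approximate solution, a separating hyperplane
`h x = δ`, or failure. -/
inductive Outcome (K : Type) (n : ℕ) : Type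
  | solution : (Fin n → K) → Outcome K n
  | hyperplane : (Fin n → K) → K → Outcome K n
  | failure : Outcome K n

/-- The first row of `Cx ≤ d` with `(c_k z - d_k) / ‖c_k‖ ≥ r`, where `rsq = r²`, if there is one. -/
def violatedRow {n : ℕ} : {l : ℕ} → (Fin l → Fin n → K) → (Fin l → K) → (Fin n → K) → K →
    Prog K (Option ((Fin n → K) × K))
  | 0, _, _, _, _ => ret none
  | _ + 1, C, d, z, rsq => do
      let zero ← const 0
      let p ← dot (C 0) z
      let g ← sub p (d 0)
      let gsq ← mul g g
      let csq ← dot (C 0) (C 0)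
      let bound ← mul rsq csq
      let negative ← less g zero
      let near ← less gsq bound
      if negative || near then violatedRow (Fin.tail C) (Fin.tail d) z rsq
      else return some (C 0, d 0)

/-- The elementary procedure for `(z, r)`, where `rsq = r²`. The list `es` holds the orthogonalized
equations. -/
def elementary {n l : ℕ} (es : List (Equation K n)) (C : Fin l → Fin n → K) (d : Fin l → K)
    (z : Fin n → K) (rsq : K) : Prog K (Outcome K n) := do
  let p ← project es z
  let h ← vsub z p
  let hsq ← dot h h
  let close ← less hsq rsq
  if close then
    let row ← violatedRow C d z rsq
    match row with
    | none => return .solution p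
    | some (c, δ) => return .hyperplane c δ
  else
    let δ ← dot h p
    return .hyperplane h δ

/-- The largest of `csq` and the numbers `‖c_k‖²`. -/
def maxNormSq {n : ℕ} : {l : ℕ} → K → (Fin l → Fin n → K) → Prog K K
  | 0, csq, _ => ret csq
  | _ + 1, csq, C => do
      let s ← dot (C 0) (C 0)
      let larger ← less csq s
      maxNormSq (if larger then s else csq) (Fin.tail C)

/-- The test `r ≤ ε / (2 ‖c_max‖)`, from `rsq = r²`, `cmaxsq = ‖c_max‖²` and `ε ≥ 0`. -/
def smallRadius (cmaxsq ε rsq : K) : Prog K Bool := do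
  let four ← const 4
  let a ← mul rsq cmaxsq
  let a4 ← mul four a
  let εsq ← mul ε ε
  let large ← less εsq a4
  return !large

/-- The test whether `h₁ = -γ h₂` for some `γ > 0` (and `h₁, h₂ ≠ 0`), through the case of equality of
the Cauchy-Schwarz inequality: `h₁ · h₂ < 0` and `‖h₁‖² ‖h₂‖² ≤ (h₁ · h₂)²`. -/
def opposite {n : ℕ} (h₁ h₂ : Fin n → K) : Prog K Bool := do
  let zero ← const 0
  let p ← dot h₁ h₂
  let psq ← mul p p
  let s₁ ← dot h₁ h₁
  let s₂ ← dot h₂ h₂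
  let s ← mul s₁ s₂
  let negative ← less p zero
  let strict ← less psq s
  return negative && !strict

/-- `(h z - δ) / (h · h)` -/
def stepLength {n : ℕ} (h : Fin n → K) (δ : K) (z : Fin n → K) : Prog K K := do
  let p ← dot h z
  let g ← sub p δ
  let s ← dot h h
  div g s

/-- The choice of `α` in `combine` below: if the hyperplanes `(h₁, δ₁)` and `(h₂, δ₂)` have distance at
least `r / (7/5)` from `z` and from the projection `z₀` of `z` onto `(h₁, δ₁)`, then the hyperplane for
`α = λ₁ / (λ₁ + λ₂)` has distance at least `r` from `z`. -/
theorem combination_far {E : Type*} [NormedAddCommGroup E] [InnerProductSpace ℝ E]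
    (h₁ h₂ z z₀ : E) (δ₁ δ₂ r lam₁ lam₂ α : ℝ) (hr : 0 < r) (hh₁ : h₁ ≠ 0) (hh₂ : h₂ ≠ 0)
    (hlam₁ : lam₁ = (inner ℝ h₁ z - δ₁) / inner ℝ h₁ h₁) (hz₀ : z₀ = z - lam₁ • h₁)
    (hlam₂ : lam₂ = (inner ℝ h₂ z₀ - δ₂) / inner ℝ h₂ h₂)
    (hfar₁ : r / (7 / 5) * ‖h₁‖ ≤ inner ℝ h₁ z - δ₁)
    (hfar₂ : r / (7 / 5) * ‖h₂‖ ≤ inner ℝ h₂ z₀ - δ₂)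
    (hα : α = lam₁ / (lam₁ + lam₂)) :
    0 ≤ α ∧ α ≤ 1 ∧
      r * ‖α • h₁ + (1 - α) • h₂‖ ≤
        inner ℝ (α • h₁ + (1 - α) • h₂) z - (α * δ₁ + (1 - α) * δ₂) := by
  have n₁ : 0 < ‖h₁‖ := norm_pos_iff.mpr hh₁
  have n₂ : 0 < ‖h₂‖ := norm_pos_iff.mpr hh₂
  rw [real_inner_self_eq_norm_sq] at hlam₁ hlam₂
  have e₁ : lam₁ * ‖h₁‖ ^ 2 = inner ℝ h₁ z - δ₁ := by rw [hlam₁]; field_simp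
  have e₂ : lam₂ * ‖h₂‖ ^ 2 = inner ℝ h₂ z₀ - δ₂ := by rw [hlam₂]; field_simp
  have s₁ : r / (7 / 5) ≤ lam₁ * ‖h₁‖ := by
    rw [← e₁] at hfar₁; nlinarith
  have s₂ : r / (7 / 5) ≤ lam₂ * ‖h₂‖ := by
    rw [← e₂] at hfar₂; nlinarith
  have r' : 0 < r / (7 / 5) := by positivity
  have p₁ : 0 < lam₁ := pos_of_mul_pos_left (lt_of_lt_of_le r' s₁) n₁.le
  have p₂ : 0 < lam₂ := pos_of_mul_pos_left (lt_of_lt_of_le r' s₂) n₂.le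
  have hα' : 1 - α = lam₂ / (lam₁ + lam₂) := by rw [hα]; field_simp; ring
  rw [hα', hα]
  refine ⟨by positivity, by rw [div_le_one (by positivity)]; linarith, ?_⟩
  set p : ℝ := inner ℝ h₁ h₂ with hp
  have f₁ : inner ℝ h₁ z = δ₁ + lam₁ * ‖h₁‖ ^ 2 := by linarith
  have f₂ : inner ℝ h₂ z = δ₂ + lam₂ * ‖h₂‖ ^ 2 + lam₁ * p := by
    rw [hz₀, inner_sub_right, inner_smul_right, real_inner_comm h₁ h₂, ← hp] at e₂
    linarith
  have habs : |p| ≤ ‖h₁‖ * ‖h₂‖ := abs_real_inner_le_norm h₁ h₂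
  set w : E := lam₁ • h₁ + lam₂ • h₂ with hw
  have hcomb : (lam₁ / (lam₁ + lam₂)) • h₁ + (lam₂ / (lam₁ + lam₂)) • h₂ =
      (1 / (lam₁ + lam₂)) • w := by
    rw [hw, smul_add, smul_smul, smul_smul]
    congr 2 <;> ring
  have hwz : inner ℝ w z = lam₁ * inner ℝ h₁ z + lam₂ * inner ℝ h₂ z := by
    rw [hw, inner_add_left, real_inner_smul_left, real_inner_smul_left]
  have hww : ‖w‖ ^ 2 = (lam₁ * ‖h₁‖) ^ 2 + (lam₂ * ‖h₂‖) ^ 2 + 2 * (lam₁ * lam₂ * p) := by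
    rw [hw, norm_add_sq_real, norm_smul, norm_smul, real_inner_smul_left, inner_smul_right,
      Real.norm_of_nonneg p₁.le, Real.norm_of_nonneg p₂.le]
    ring
  set u : ℝ := lam₁ * ‖h₁‖ with hu
  set v : ℝ := lam₂ * ‖h₂‖ with hv
  set q : ℝ := lam₁ * lam₂ * p with hq
  have hqabs : |q| ≤ u * v := by
    rw [hq, abs_mul, abs_of_pos (mul_pos p₁ p₂)]
    calc lam₁ * lam₂ * |p| ≤ lam₁ * lam₂ * (‖h₁‖ * ‖h₂‖) := by gcongr
      _ = u * v := by rw [hu, hv]; ring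
  have hqlow : -(u * v) ≤ q := (abs_le.mp hqabs).1
  have hG : 0 ≤ u ^ 2 + v ^ 2 + q := by nlinarith [sq_nonneg (u - v), sq_nonneg u, sq_nonneg v]
  have hu2 : (r / (7 / 5)) ^ 2 ≤ u ^ 2 := by gcongr
  have hv2 : (r / (7 / 5)) ^ 2 ≤ v ^ 2 := by gcongr
  have key : r * ‖w‖ ≤ u ^ 2 + v ^ 2 + q := by
    have hE : r ^ 2 ≤ u ^ 2 + v ^ 2 := by
      have h25 : (r / (7 / 5)) ^ 2 = 25 / 49 * r ^ 2 := by ring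
      rw [h25] at hu2 hv2
      linarith [sq_nonneg r]
    have hle : (r * ‖w‖) ^ 2 ≤ (u ^ 2 + v ^ 2 + q) ^ 2 := by
      have h1 : r ^ 2 * ‖w‖ ^ 2 ≤ (u ^ 2 + v ^ 2) * ‖w‖ ^ 2 :=
        mul_le_mul_of_nonneg_right hE (sq_nonneg _)
      rw [hww] at h1
      rw [mul_pow, hww]
      have h2 : (u ^ 2 + v ^ 2 + q) ^ 2 - (u ^ 2 + v ^ 2) * (u ^ 2 + v ^ 2 + 2 * q) = q ^ 2 := by
        ring
      linarith [sq_nonneg q]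
    exact (abs_le_of_sq_le_sq' hle hG).2
  rw [hcomb, norm_smul, real_inner_smul_left, hwz, f₁, f₂,
    Real.norm_of_nonneg (by positivity)]
  have hpos : 0 < lam₁ + lam₂ := by positivity
  have : 1 / (lam₁ + lam₂) * (lam₁ * (δ₁ + lam₁ * ‖h₁‖ ^ 2) +
      lam₂ * (δ₂ + lam₂ * ‖h₂‖ ^ 2 + lam₁ * p)) -
      (lam₁ / (lam₁ + lam₂) * δ₁ + lam₂ / (lam₁ + lam₂) * δ₂) =
      1 / (lam₁ + lam₂) * (u ^ 2 + v ^ 2 + q) := by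
    rw [hu, hv, hq]; field_simp; ring
  rw [this]
  calc r * (1 / (lam₁ + lam₂) * ‖w‖) = 1 / (lam₁ + lam₂) * (r * ‖w‖) := by ring
    _ ≤ _ := by gcongr

/-- The hyperplane `α h₁ + (1 - α) h₂`, `α δ₁ + (1 - α) δ₂`, with `α = λ₁ / (λ₁ + λ₂)`. Here `λ₁ h₁` is
the step from `z` to its projection `z₀` onto `(h₁, δ₁)`, and `λ₂ h₂` the step from `z₀` to its
projection onto `(h₂, δ₂)`. This is a number `α` in `[0, 1]` with `(h z - δ) / ‖h‖ ≥ r`; see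
`combination_far`. -/
def combine {n : ℕ} (lam₁ lam₂ : K) (h₁ : Fin n → K) (δ₁ : K) (h₂ : Fin n → K) (δ₂ : K) :
    Prog K (Outcome K n) := do
  let one ← const 1
  let s ← add lam₁ lam₂
  let α ← div lam₁ s
  let α' ← sub one α
  let h ← vec (fun i => do
    let x ← mul α (h₁ i)
    let y ← mul α' (h₂ i)
    add x y)
  let x ← mul α δ₁
  let y ← mul α' δ₂
  let δ ← add x y
  return .hyperplane h δ

/-- The recursion of the divide and conquer algorithm for `(z, r, ε)`, with `1 + θ = 7/5`, where
`rsq = r²`. The first explicit argument bounds the depth of the recursion. -/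
def recursion {n l : ℕ} (es : List (Equation K n)) (C : Fin l → Fin n → K) (d : Fin l → K)
    (cmaxsq ε : K) : ℕ → (Fin n → K) → K → Prog K (Outcome K n)
  | fuel, z, rsq => do
      let small ← smallRadius cmaxsq ε rsq
      if small then elementary es C d z rsq
      else
        match fuel with
        | 0 => outOfFuel
        | fuel + 1 =>
            let c25 ← const 25
            let c49 ← const 49
            let ratio ← div c25 c49
            let rsq' ← mul ratio rsq
            let first ← recursion es C d cmaxsq ε fuel z rsq'
            match first with
            | .solution x => return .solution x
            | .failure => return .failure
            | .hyperplane h₁ δ₁ =>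
                let lam₁ ← stepLength h₁ δ₁ z
                let z₀ ← subSmul z lam₁ h₁
                let second ← recursion es C d cmaxsq ε fuel z₀ rsq'
                match second with
                | .solution x => return .solution x
                | .failure => return .failure
                | .hyperplane h₂ δ₂ =>
                    let fails ← opposite h₁ h₂
                    if fails then return .failure
                    else
                      let lam₂ ← stepLength h₂ δ₂ z₀
                      combine lam₁ lam₂ h₁ δ₁ h₂ δ₂

/-- The divide and conquer algorithm for the system `Ax = b`, `Cx ≤ d` and the triple `(z, r, ε)`, where
`rsq = r²`. -/
def divideAndConquer {m n l : ℕ} (fuel : ℕ) (A : Fin m → Fin n → K) (b : Fin m → K)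
    (C : Fin l → Fin n → K) (d : Fin l → K) (z : Fin n → K) (rsq ε : K) :
    Prog K (Outcome K n) := do
  let es ← orthogonalize [] A b
  let zero ← const 0
  let cmaxsq ← maxNormSq zero C
  recursion es C d cmaxsq ε fuel z rsq

/-! ## The LFS algorithm -/

/-- The LFS algorithm for `Ax = b`, `-x ≤ 0`: one run of the divide and conquer algorithm on
`Ax - bt = 0`, `-x ≤ -1`, `-t ≤ -2` with center `0`, radius `2 n Δ √(r² + 1)` and `ε = 1`. The result is
`some (x / t)` if that run finds an approximate solution `(x, t)`, and `none`, which means that the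
system is declared infeasible, otherwise. -/
def lfs {m n : ℕ} (fuel : ℕ) (A : Fin m → Fin n → K) (b : Fin m → K) (Δ r : K) :
    Prog K (Option (Fin n → K)) := do
  let zero ← const 0
  let one ← const 1
  let two ← const 2
  let minusOne ← neg one
  let minusTwo ← neg two
  let minusB ← vec (fun i => neg (b i))
  let A' : Fin m → Fin (n + 1) → K := fun i => Fin.snoc (A i) (minusB i)
  let C : Fin (n + 1) → Fin (n + 1) → K := fun k j => if k = j then minusOne else zero
  let d : Fin (n + 1) → K := Fin.snoc (fun _ => minusOne) minusTwo
  let dim ← const n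
  let a ← mul two dim
  let a' ← mul a Δ
  let asq ← mul a' a'
  let rsq ← mul r r
  let w ← add rsq one
  let radiusSq ← mul asq w
  let outcome ← divideAndConquer fuel A' (fun _ => zero) C d (fun _ => zero) radiusSq one
  match outcome with
  | .solution y => do
      let x ← vec (fun i => div (y (Fin.castSucc i)) (y (Fin.last n)))
      return some x
  | .hyperplane _ _ => return none
  | .failure => return none

/-! ## The feasibility problem -/

/-- The feasible region `{x : Ax = b, -x ≤ 0}`. -/
def feasibleRegion {m n : ℕ} (A : Matrix (Fin m) (Fin n) ℤ) (b : Fin m → ℤ) : Set (Fin n → ℝ) :=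
  {x | (A.map (Int.cast : ℤ → ℝ)).mulVec x = (fun i => (b i : ℝ)) ∧ ∀ i, -x i ≤ 0}

/-- The largest absolute value of the determinant of an `m × m` submatrix. -/
noncomputable def maxSubdet {m n : ℕ} (A : Matrix (Fin m) (Fin n) ℤ) : ℕ :=
  (Finset.univ : Finset (Fin m ↪o Fin n)).sup (fun f => (A.submatrix id f).det.natAbs)

end Chubanov

/-! ### Values and step counts of programs -/

namespace Prog

/-! If `P` is nonempty, the homogenized system has a solution inside the search ball. Since `P` is
bounded, a point of `P` with positive `i`-th coordinate can be moved to a basic feasible solution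
that keeps this coordinate positive. By Cramer's rule and integrality the coordinate is then at
least `1/Δ`. Averaging one such solution for each `i` gives `y ∈ P` with all coordinates at least
`1/(nΔ)` (`exists_feasible_coordinates_large`). With `τ = 2nΔ`, the point `(τy, τ)` satisfies the
strengthened inequalities and has norm below `τ√(r²+1)`, the radius of the search. So a hyperplane
separating that ball from the solutions, or a proof of infeasibility, shows that `P` is empty.
Conversely, the tolerance `ε = 1` still leaves `x > 0` and `t > 1`, so that `x/t ∈ P`.

The recursion carries the invariant `Outcome.IsCorrect` (`run_recursion`). The leaves are settled by
`run_elementary`. At an inner node `combination_far` gives the distance of the combined hyperplane,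
and oppositely directed normals give a contradiction between two valid inequalities.

The radius shrinks by `5/7` per level, so a depth `N` of about `log (2ρ) / log (7/5)` suffices and
`2 ^ N = O(ρ ^ (1 / log₂ (7/5)))` (`exists_pow_depth`). The equations are orthogonalized only once,
so a leaf costs `O(mn + n²) = O(n²)` because `m ≤ n`, and an inner node costs `O(n)` by itself. This
already yields `m²n + n²m + ρ ^ (1 / log₂ (7/5)) n²`; the cubic and logarithmic terms of the claim
are only slack. -/

theorem run_bind {K α β : Type} [Field K] [LinearOrder K] (p : Prog K α) (g : α → Prog K β) :
    (p >>= g).run = p.run.bind fun r => (g r.1).run.map fun s => (s.1, r.2 + s.2) := by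
  change (Prog.bind p g).run = _
  induction p with
  | ret x => simp [Prog.bind, run]
  | lit k f ih =>
    simp only [Prog.bind, run, ih]
    cases (f k).run <;> simp [Option.map_map, Function.comp_def, Nat.add_right_comm]
  | op o x y f ih =>
    simp only [Prog.bind, run]
    cases o.eval x y with
    | none => rfl
    | some v =>
      simp only [ih]
      cases (f v).run <;> simp [Option.map_map, Function.comp_def, Nat.add_right_comm]
  | lt x y f ih =>
    simp only [Prog.bind, run, ih]
    cases (f (decide (x < y))).run <;>
      simp [Option.map_map, Function.comp_def, Nat.add_right_comm]
  | outOfFuel => rfl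

section Values

variable {K α : Type} [Field K] [LinearOrder K]

theorem run_pure (a : α) : (pure a : Prog K α).run = some (a, 0) := rfl

theorem run_ret (a : α) : (ret a : Prog K α).run = some (a, 0) := rfl

theorem run_const (k : ℕ) : (const k : Prog K K).run = some ((k : K), 1) := rfl

theorem run_add (x y : K) : (add x y).run = some (x + y, 1) := rfl

theorem run_sub (x y : K) : (sub x y).run = some (x - y, 1) := rfl

theorem run_mul (x y : K) : (mul x y).run = some (x * y, 1) := rfl

theorem run_div {y : K} (hy : y ≠ 0) (x : K) : (div x y).run = some (x / y, 1) := by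
  simp [div, run, ArithOp.eval, hy]

theorem run_less (x y : K) : (less x y).run = some (decide (x < y), 1) := rfl

theorem run_neg (x : K) : (neg x).run = some (-x, 2) := by
  simp [neg, run_bind, run_const, run_sub]

theorem run_vec {n : ℕ} {f : Fin n → Prog K α} (v : Fin n → α) (t : ℕ)
    (h : ∀ i, (f i).run = some (v i, t)) : (vec f).run = some (v, n * t) := by
  induction n with
  | zero =>
    simp only [vec, run, Option.some.injEq, Prod.mk.injEq]
    exact ⟨Subsingleton.elim _ _, by simp⟩
  | succ n ih =>
    simp only [vec, run_bind, h, ih (fun i => v i.succ) (fun i => h i.succ), run_pure,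
      Option.bind_some, Option.map_some, Option.some.injEq, Prod.mk.injEq]
    exact ⟨Fin.cons_self_tail v, by ring⟩

theorem run_dot {n : ℕ} (u v : Fin n → K) : (dot u v).run = some (u ⬝ᵥ v, 2 * n + 1) := by
  induction n with
  | zero => simp [dot, run_const, dotProduct]
  | succ n ih =>
    simp only [dot, run_bind, run_mul, ih, run_add, Option.bind_some, Option.map_some,
      Option.some.injEq, Prod.mk.injEq]
    exact ⟨by simp [dotProduct, Fin.sum_univ_succ, Fin.tail], by ring⟩

theorem run_vsub {n : ℕ} (u v : Fin n → K) : (vsub u v).run = some (u - v, n) := by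
  rw [vsub, run_vec (u - v) 1 fun i => run_sub _ _, mul_one]

theorem run_subSmul {n : ℕ} (u : Fin n → K) (c : K) (v : Fin n → K) :
    (subSmul u c v).run = some (u - c • v, n * 2) := by
  rw [subSmul, run_vec (u - c • v) 2 fun i => ?_]
  simp [run_bind, run_mul, run_sub]

end Values
end Prog

namespace Chubanov
open Prog

/-! ## Orthogonalization and projection -/

/-- Mutually orthogonal equations with nonzero left-hand sides. -/
def IsOrthogonal {n : ℕ} (es : List (Equation ℝ n)) : Prop :=
  es.Pairwise (fun e f => e.q ⬝ᵥ f.q = 0) ∧ ∀ e ∈ es, e.normSq = e.q ⬝ᵥ e.q ∧ e.q ≠ 0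

/-- The solution set of a list of equations. -/
def solutions {n : ℕ} (es : List (Equation ℝ n)) : Set (Fin n → ℝ) :=
  {y | ∀ e ∈ es, e.q ⬝ᵥ y = e.rhs}

theorem IsOrthogonal.tail {n : ℕ} {e : Equation ℝ n} {es : List (Equation ℝ n)}
    (h : IsOrthogonal (e :: es)) : IsOrthogonal es :=
  ⟨h.1.of_cons, fun f hf => h.2 f (List.mem_cons_of_mem _ hf)⟩

theorem IsOrthogonal.normSq_ne_zero {n : ℕ} {es : List (Equation ℝ n)}
    (h : IsOrthogonal es) {e : Equation ℝ n} (he : e ∈ es) : e.normSq ≠ 0 := by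
  rw [(h.2 e he).1]
  exact fun h0 => (h.2 e he).2 (dotProduct_self_eq_zero.mp h0)

/-- Each step subtracts a multiple of an equation in the list, so on the solutions of the list the
old and the new equation are equivalent. The subspace `W` stands for the span of the rows already
treated; the congruence of `e.q` and `v` modulo `W` will show that a new row does not reduce to
zero. -/
theorem run_reduceEquation {n : ℕ} (es : List (Equation ℝ n)) (hes : IsOrthogonal es)
    (W : Submodule ℝ (Fin n → ℝ)) (hW : ∀ e ∈ es, e.q ∈ W) (v : Fin n → ℝ) (β : ℝ) :
    ∃ e : Equation ℝ n,
      (reduceEquation es v β).run = some (e, es.length * (4 * n + 4) + (2 * n + 1)) ∧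
      e.normSq = e.q ⬝ᵥ e.q ∧ e.q - v ∈ W ∧
      (∀ w, (∀ f ∈ es, f.q ⬝ᵥ w = 0) → e.q ⬝ᵥ w = v ⬝ᵥ w) ∧
      (∀ f ∈ es, e.q ⬝ᵥ f.q = 0) ∧
      ∀ y ∈ solutions es, (e.q ⬝ᵥ y = e.rhs ↔ v ⬝ᵥ y = β) := by
  induction es generalizing v β with
  | nil =>
    refine ⟨⟨v, β, v ⬝ᵥ v⟩, ?_, rfl, by simp, by simp, by simp, by simp⟩
    simp [reduceEquation, run_bind, run_dot, run_pure]
  | cons e es ih =>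
    have h0 := hes.normSq_ne_zero (List.mem_cons_self (a := e) (l := es))
    set c := e.q ⬝ᵥ v / e.normSq with hc
    obtain ⟨e', hrun, hn, hmem, hdot, hort, hsol⟩ := ih hes.tail
      (fun f hf => hW f (List.mem_cons_of_mem _ hf)) (v - c • e.q) (β - c * e.rhs)
    refine ⟨e', ?_, hn, ?_, ?_, ?_, ?_⟩
    · simp only [reduceEquation, run_bind, run_dot, run_div h0, run_subSmul, run_mul, run_sub,
        Option.bind_some, Option.map_some, ← hc, hrun]
      congr 2
      simp only [List.length_cons]; ring
    · have h1 : e'.q - v = (e'.q - (v - c • e.q)) - c • e.q := by abel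
      rw [h1]
      exact W.sub_mem hmem (W.smul_mem _ (hW e List.mem_cons_self))
    · intro w hw
      rw [hdot w fun f hf => hw f (List.mem_cons_of_mem _ hf)]
      simp [hw e List.mem_cons_self]
    · intro f hf
      rcases List.mem_cons.mp hf with rfl | hf
      -- The choice of `c` makes `v - c • e.q` orthogonal to `e.q`; the remaining reductions keep
      -- this, because `e.q` is orthogonal to the rest of the list.
      · rw [hdot _ fun g hg => by
          rw [dotProduct_comm]; exact List.rel_of_pairwise_cons hes.1 hg]
        rw [sub_dotProduct, smul_dotProduct, ← (hes.2 f List.mem_cons_self).1, smul_eq_mul, hc,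
          div_mul_cancel₀ _ h0, dotProduct_comm, sub_self]
      · exact hort f hf
    · intro y hy
      rw [hsol y fun f hf => hy f (List.mem_cons_of_mem _ hf), sub_dotProduct, smul_dotProduct,
        hy e List.mem_cons_self, smul_eq_mul, sub_left_inj]

/-- The hypothesis `hA` is independence of the remaining rows modulo `W`. This form survives the
induction, in which `W` grows by the row just treated. -/
theorem run_orthogonalize {n m : ℕ} (es : List (Equation ℝ n)) (hes : IsOrthogonal es)
    (W : Submodule ℝ (Fin n → ℝ)) (hW : ∀ e ∈ es, e.q ∈ W) (A : Fin m → Fin n → ℝ)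
    (b : Fin m → ℝ) (hA : ∀ c : Fin m → ℝ, ∑ i, c i • A i ∈ W → c = 0) :
    ∃ (fs : List (Equation ℝ n)) (t : ℕ), (orthogonalize es A b).run = some (fs, t) ∧
      t ≤ m * ((es.length + m) * (4 * n + 4) + (2 * n + 1)) ∧ fs.length = es.length + m ∧
      IsOrthogonal fs ∧ solutions fs = {y | y ∈ solutions es ∧ ∀ i, A i ⬝ᵥ y = b i} := by
  induction m generalizing es W with
  | zero => exact ⟨es, 0, by simp [orthogonalize, run_ret], by simp, by simp, hes, by simp⟩
  | succ m ih =>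
    obtain ⟨e, hrun, hn, hmem, -, hort, hsol⟩ := run_reduceEquation es hes W hW (A 0) (b 0)
    have he0 : e.q ≠ 0 := by
      intro h0
      rw [h0, zero_sub, Submodule.neg_mem_iff] at hmem
      have := congrFun (hA (Pi.single 0 1) (by simpa [Pi.single_apply, ite_smul] using hmem)) 0
      simp at this
    obtain ⟨fs, t, hrun', ht, hlen, hfs, hsol'⟩ := ih (e :: es)
      ⟨List.pairwise_cons.mpr ⟨hort, hes.1⟩, by
        rintro f (_ | ⟨_, hf⟩)
        exacts [⟨hn, he0⟩, hes.2 f hf]⟩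
      (W ⊔ ℝ ∙ A 0) (by
        rintro f (_ | ⟨_, hf⟩)
        · have h1 : e.q = (e.q - A 0) + A 0 := by abel
          rw [h1]
          exact Submodule.add_mem_sup hmem (Submodule.mem_span_singleton_self _)
        · exact Submodule.mem_sup_left (hW f hf))
      (Fin.tail A) (Fin.tail b) (by
        intro c hc
        obtain ⟨w, hw, s, hs, hws⟩ := Submodule.mem_sup.mp hc
        obtain ⟨a, rfl⟩ := Submodule.mem_span_singleton.mp hs
        -- A relation modulo `W ⊔ ℝ ∙ A 0` is a relation modulo `W` once `A 0` receives the
        -- coefficient `-a`.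
        have := hA (Fin.cons (-a) c) (by
          simp only [Fin.sum_univ_succ, Fin.cons_zero, Fin.cons_succ]
          have h2 : w = -a • A 0 + ∑ i : Fin m, c i • A i.succ := by
            simp only [Fin.tail] at hws
            rw [← hws, neg_smul]; abel
          rwa [← h2])
        funext i
        simpa using congrFun this i.succ)
    refine ⟨fs, es.length * (4 * n + 4) + (2 * n + 1) + t, by
      simp only [orthogonalize, run_bind, hrun, hrun', Option.bind_some, Option.map_some], ?_,
      by rw [hlen, List.length_cons]; ring, hfs, ?_⟩
    · simp only [List.length_cons] at ht
      have e1 : es.length + 1 + m = es.length + (m + 1) := by ring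
      rw [e1] at ht
      have : es.length * (4 * n + 4) ≤ (es.length + (m + 1)) * (4 * n + 4) := by gcongr; omega
      linarith
    · rw [hsol']
      ext y
      simp only [solutions, Set.mem_ofPred_eq, List.forall_mem_cons, Fin.forall_fin_succ, Fin.tail]
      have := hsol y
      simp only [solutions, Set.mem_ofPred_eq] at this
      tauto

/-- Projecting onto one hyperplane after another is exact here: by orthogonality a later step does
not disturb an equation that already holds. The displacement `z - p` is a combination of the
left-hand sides, hence constant on the solution set. -/
theorem run_project {n : ℕ} (es : List (Equation ℝ n)) (hes : IsOrthogonal es) (z : Fin n → ℝ) :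
    ∃ p : Fin n → ℝ, (project es z).run = some (p, es.length * (4 * n + 3)) ∧
      p ∈ solutions es ∧ (∀ v, (∀ e ∈ es, v ⬝ᵥ e.q = 0) → v ⬝ᵥ p = v ⬝ᵥ z) ∧
      ∀ y ∈ solutions es, (z - p) ⬝ᵥ y = (z - p) ⬝ᵥ p := by
  induction es generalizing z with
  | nil => exact ⟨z, by simp [project, run_ret], by simp [solutions], by simp, by simp⟩
  | cons e es ih =>
    have h0 := hes.normSq_ne_zero (List.mem_cons_self (a := e) (l := es))
    set c := (e.q ⬝ᵥ z - e.rhs) / e.normSq with hc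
    obtain ⟨p, hrun, hp, hv, hy⟩ := ih hes.tail (z - c • e.q)
    have hep : e.q ⬝ᵥ p = e.rhs := by
      rw [hv _ fun f hf => List.rel_of_pairwise_cons hes.1 hf, dotProduct_sub, dotProduct_smul,
        ← (hes.2 e List.mem_cons_self).1, smul_eq_mul, hc, div_mul_cancel₀ _ h0]
      ring
    refine ⟨p, ?_, List.forall_mem_cons.mpr ⟨hep, hp⟩, ?_, ?_⟩
    · simp only [project, run_bind, run_dot, run_div h0, run_subSmul, run_sub,
        Option.bind_some, Option.map_some, ← hc, hrun]
      congr 2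
      simp only [List.length_cons]; ring
    · intro v h
      rw [hv v fun f hf => h f (List.mem_cons_of_mem _ hf), dotProduct_sub, dotProduct_smul,
        h e List.mem_cons_self, smul_zero, sub_zero]
    · intro y hy'
      have h1 := hy y fun f hf => hy' f (List.mem_cons_of_mem _ hf)
      have h2 : z - p = (z - c • e.q - p) + c • e.q := by abel
      rw [h2, add_dotProduct, add_dotProduct, h1, smul_dotProduct, smul_dotProduct, hep,
        hy' e List.mem_cons_self]

/-! ## Correctness of the divide and conquer algorithm -/

/-- The type `Fin n → ℝ` carries the sup norm; Euclidean norms are reached through `WithLp.toLp 2`.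
-/
theorem dotProduct_eq_inner {n : ℕ} (x y : Fin n → ℝ) :
    x ⬝ᵥ y = inner ℝ (WithLp.toLp 2 x) (WithLp.toLp 2 y) := by
  rw [EuclideanSpace.inner_toLp_toLp, star_trivial, dotProduct_comm]

theorem dotProduct_self_eq_sq {n : ℕ} (x : Fin n → ℝ) :
    x ⬝ᵥ x = ‖WithLp.toLp 2 x‖ ^ 2 := by
  rw [dotProduct_eq_inner, real_inner_self_eq_norm_sq]

theorem dotProduct_le_norm_mul {n : ℕ} (x y : Fin n → ℝ) :
    x ⬝ᵥ y ≤ ‖WithLp.toLp 2 x‖ * ‖WithLp.toLp 2 y‖ := by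
  rw [dotProduct_eq_inner]; exact real_inner_le_norm _ _

theorem norm_toLp_pos {n : ℕ} {x : Fin n → ℝ} (hx : x ≠ 0) : 0 < ‖WithLp.toLp 2 x‖ := by
  rw [norm_pos_iff]
  exact fun h => hx ((WithLp.toLp_eq_zero 2).mp h)

/-- The lower bounds on `v` are needed at the leaves, the upper bound for the depth of the
recursion. -/
theorem run_maxNormSq {n l : ℕ} (s : ℝ) (C : Fin l → Fin n → ℝ) :
    ∃ v : ℝ, (maxNormSq s C).run = some (v, l * (2 * n + 2)) ∧ s ≤ v ∧
      (∀ k, C k ⬝ᵥ C k ≤ v) ∧ ∀ M, s ≤ M → (∀ k, C k ⬝ᵥ C k ≤ M) → v ≤ M := by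
  induction l generalizing s with
  | zero => exact ⟨s, by simp [maxNormSq, run_ret], le_rfl, by simp, fun M h _ => h⟩
  | succ l ih =>
    obtain ⟨v, hrun, hs, hC, hM⟩ := ih (max s (C 0 ⬝ᵥ C 0)) (Fin.tail C)
    refine ⟨v, ?_, (le_max_left _ _).trans hs,
      Fin.forall_fin_succ.mpr ⟨(le_max_right _ _).trans hs, hC⟩,
      fun M h1 h2 => hM M (max_le h1 (h2 0)) fun k => h2 k.succ⟩
    have hmax : (if decide (s < C 0 ⬝ᵥ C 0) = true then C 0 ⬝ᵥ C 0 else s) =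
        max s (C 0 ⬝ᵥ C 0) := by
      rw [max_def_lt]; simp
    simp only [maxNormSq, run_bind, run_dot, run_less, Option.bind_some, Option.map_some, hmax,
      hrun]
    congr 2; ring

/-- Since `ρ > 0`, the inequality `g ≥ ρ ‖c‖` amounts to `g ≥ 0` and `g² ≥ ρ² ‖c‖²`, which is what
the program tests. -/
theorem run_violatedRow {n l : ℕ} (C : Fin l → Fin n → ℝ) (d : Fin l → ℝ) (z : Fin n → ℝ)
    {ρ : ℝ} (hρ : 0 < ρ) :
    ∃ (row : Option ((Fin n → ℝ) × ℝ)) (t : ℕ),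
      (violatedRow C d z (ρ ^ 2)).run = some (row, t) ∧ t ≤ l * (4 * n + 8) ∧
      (row = none → ∀ k, C k ≠ 0 → C k ⬝ᵥ z - d k < ρ * ‖WithLp.toLp 2 (C k)‖) ∧
      ∀ c δ, row = some (c, δ) →
        ρ * ‖WithLp.toLp 2 c‖ ≤ c ⬝ᵥ z - δ ∧ ∃ k, c = C k ∧ δ = d k := by
  induction l with
  | zero => exact ⟨none, 0, by simp [violatedRow, run_ret], by simp, by simp, by simp⟩
  | succ l ih =>
    obtain ⟨row, t, hrun, ht, hnone, hsome⟩ := ih (Fin.tail C) (Fin.tail d)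
    set g := C 0 ⬝ᵥ z - d 0 with hg
    have hstep := fun p : Bool => apply_ite (fun q : Prog ℝ (Option ((Fin n → ℝ) × ℝ)) => q.run)
      (p = true) (violatedRow (Fin.tail C) (Fin.tail d) z (ρ ^ 2)) (pure (some (C 0, d 0)))
    by_cases hb : g < 0 ∨ g * g < ρ ^ 2 * (C 0 ⬝ᵥ C 0)
    · refine ⟨row, 4 * n + 8 + t, ?_, ?_, ?_, ?_⟩
      · simp only [violatedRow, run_bind, run_const, run_dot, run_sub, run_mul, run_less,
          Option.bind_some, ← hg, hstep, Nat.cast_zero]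
        rw [if_pos (by simpa using hb), hrun]
        simp only [Option.map_some]
        congr 2; omega
      · have : (l + 1) * (4 * n + 8) = l * (4 * n + 8) + (4 * n + 8) := by ring
        omega
      · intro h
        refine Fin.forall_fin_succ.mpr ⟨fun h0 => ?_, hnone h⟩
        have hpos := mul_pos hρ (norm_toLp_pos h0)
        rcases hb with hb | hb
        · exact hb.trans hpos
        · rw [dotProduct_self_eq_sq, ← mul_pow, ← pow_two] at hb
          exact lt_of_pow_lt_pow_left₀ 2 hpos.le hb
      · intro c δ h
        obtain ⟨h1, k, h2⟩ := hsome c δ h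
        exact ⟨h1, k.succ, h2⟩
    · refine ⟨some (C 0, d 0), 4 * n + 8, ?_, ?_, by simp, ?_⟩
      · simp only [violatedRow, run_bind, run_const, run_dot, run_sub, run_mul, run_less,
          Option.bind_some, ← hg, hstep, Nat.cast_zero]
        rw [if_neg (by simpa using hb), run_pure]
        simp only [Option.map_some]
        congr 2; omega
      · have : (l + 1) * (4 * n + 8) = l * (4 * n + 8) + (4 * n + 8) := by ring
        omega
      · intro c δ h
        simp only [Option.some.injEq, Prod.mk.injEq] at h
        obtain ⟨rfl, rfl⟩ := h
        refine ⟨?_, 0, rfl, rfl⟩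
        push Not at hb
        rw [dotProduct_self_eq_sq, ← mul_pow, ← pow_two] at hb
        exact (abs_le_of_sq_le_sq' hb.2 hb.1).2

/-- The solution set of the equations `es` and the inequalities `Cy ≤ d`. -/
def feasibleSet {n l : ℕ} (es : List (Equation ℝ n)) (C : Fin l → Fin n → ℝ) (d : Fin l → ℝ) :
    Set (Fin n → ℝ) :=
  {y | y ∈ solutions es ∧ ∀ k, C k ⬝ᵥ y ≤ d k}

/-- What an outcome of the divide and conquer algorithm for `(z, ρ, ε)` means: an approximate
solution, a hyperplane that separates the feasible set from the ball around `z` of radius `ρ`, or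
infeasibility. -/
def Outcome.IsCorrect {n l : ℕ} (es : List (Equation ℝ n)) (C : Fin l → Fin n → ℝ) (d : Fin l → ℝ)
    (ε : ℝ) (z : Fin n → ℝ) (ρ : ℝ) : Outcome ℝ n → Prop
  | .solution p => p ∈ solutions es ∧ ∀ k, C k ⬝ᵥ p < d k + ε
  | .hyperplane h δ => h ≠ 0 ∧ (∀ y ∈ feasibleSet es C d, h ⬝ᵥ y ≤ δ) ∧
      ρ * ‖WithLp.toLp 2 h‖ ≤ h ⬝ᵥ z - δ
  | .failure => feasibleSet es C d = ∅

/-- If no row is violated, `c_k z` exceeds `d_k` by less than `ρ ‖c_k‖`, and passing from `z` to `p`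
adds at most another `ρ ‖c_k‖`; `hsmall` bounds the sum of the two by `ε`. If `p` is far from `z`,
all solutions of the equations lie on the hyperplane through `p` with normal `z - p`. -/
theorem run_elementary {n l : ℕ} {es : List (Equation ℝ n)} (hes : IsOrthogonal es)
    {C : Fin l → Fin n → ℝ} (hC : ∀ k, C k ≠ 0) (d : Fin l → ℝ) {cmaxsq ε : ℝ}
    (hmax : ∀ k, C k ⬝ᵥ C k ≤ cmaxsq) (hε : 0 ≤ ε) (z : Fin n → ℝ) {ρ : ℝ} (hρ : 0 < ρ)
    (hsmall : 4 * (ρ ^ 2 * cmaxsq) ≤ ε * ε) :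
    ∃ (o : Outcome ℝ n) (t : ℕ), (elementary es C d z (ρ ^ 2)).run = some (o, t) ∧
      t ≤ es.length * (4 * n + 3) + l * (4 * n + 8) + (5 * n + 3) ∧ o.IsCorrect es C d ε z ρ := by
  obtain ⟨p, hp, hsol, -, hperp⟩ := run_project es hes z
  obtain ⟨row, t, hrow, ht, hnone, hsome⟩ := run_violatedRow C d z hρ
  have hhsq := dotProduct_self_eq_sq (z - p)
  by_cases hb : (z - p) ⬝ᵥ (z - p) < ρ ^ 2
  · have hrun : ∀ o : Outcome ℝ n, (match row with
        | none => (Outcome.solution p)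
        | some (c, δ) => .hyperplane c δ) = o →
        (elementary es C d z (ρ ^ 2)).run =
          some (o, es.length * (4 * n + 3) + (n + (2 * n + 1 + (1 + t)))) := by
      rintro o rfl
      simp only [elementary, run_bind, hp, run_vsub, run_dot, run_less, Option.bind_some]
      rw [if_pos (by simpa using hb)]
      simp only [run_bind, hrow, Option.bind_some]
      rcases row with _ | ⟨c, δ⟩ <;> simp [run_pure]
    refine ⟨_, _, hrun _ rfl, by linarith, ?_⟩
    rcases row with _ | ⟨c, δ⟩
    · refine ⟨hsol, fun k => ?_⟩
      have h1 := hnone rfl k (hC k)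
      have h2 := dotProduct_le_norm_mul (-C k) (z - p)
      have h3 : ‖WithLp.toLp 2 (z - p)‖ < ρ := by
        rw [hhsq] at hb
        exact lt_of_pow_lt_pow_left₀ 2 hρ.le hb
      have h4 : (2 * (ρ * ‖WithLp.toLp 2 (C k)‖)) ^ 2 ≤ ε ^ 2 := by
        have h5 := hmax k
        rw [dotProduct_self_eq_sq] at h5
        calc (2 * (ρ * ‖WithLp.toLp 2 (C k)‖)) ^ 2
            = 4 * (ρ ^ 2 * ‖WithLp.toLp 2 (C k)‖ ^ 2) := by ring
          _ ≤ 4 * (ρ ^ 2 * cmaxsq) := by gcongr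
          _ ≤ ε ^ 2 := by rw [pow_two ε]; exact hsmall
      have h5 := abs_le_of_sq_le_sq' h4 hε
      have h6 : ‖WithLp.toLp 2 (C k)‖ * ‖WithLp.toLp 2 (z - p)‖ ≤ ‖WithLp.toLp 2 (C k)‖ * ρ := by
        gcongr
      rw [WithLp.toLp_neg, norm_neg, neg_dotProduct, dotProduct_sub] at h2
      linarith [h5.2]
    · obtain ⟨h1, k, rfl, rfl⟩ := hsome c δ rfl
      exact ⟨hC k, fun y hy => hy.2 k, h1⟩
  · refine ⟨.hyperplane (z - p) ((z - p) ⬝ᵥ p),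
      es.length * (4 * n + 3) + (n + (2 * n + 1 + (1 + (2 * n + 1)))), ?_, by linarith, ?_⟩
    · simp only [elementary, run_bind, hp, run_vsub, run_dot, run_less, Option.bind_some]
      rw [if_neg (by simpa using hb)]
      simp [run_bind, run_dot, run_pure]
    · rw [hhsq, not_lt] at hb
      have h1 := (abs_le_of_sq_le_sq' hb (norm_nonneg _)).2
      refine ⟨?_, fun y hy => (hperp y hy.1).le, ?_⟩
      · intro h0
        rw [h0, WithLp.toLp_zero, norm_zero] at h1
        linarith
      · rw [← dotProduct_sub, hhsq, pow_two]
        gcongr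

/-! ### Combining hyperplanes and the recursion -/

theorem run_smallRadius (cmaxsq ε rsq : ℝ) :
    (smallRadius cmaxsq ε rsq).run =
      some (decide (4 * (rsq * cmaxsq) ≤ ε * ε), 5) := by
  simp [smallRadius, run_bind, run_const, run_mul, run_less, run_pure, ← not_lt]

theorem run_opposite {n : ℕ} (h₁ h₂ : Fin n → ℝ) :
    (opposite h₁ h₂).run =
      some (decide (h₁ ⬝ᵥ h₂ < 0 ∧
        (h₁ ⬝ᵥ h₁) * (h₂ ⬝ᵥ h₂) ≤ (h₁ ⬝ᵥ h₂) * (h₁ ⬝ᵥ h₂)), 6 * n + 8) := by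
  simp [opposite, run_bind, run_const, run_mul, run_dot, run_less, run_pure, ← not_lt]
  ring

theorem run_stepLength {n : ℕ} {h : Fin n → ℝ} (hh : h ≠ 0) (δ : ℝ) (z : Fin n → ℝ) :
    (stepLength h δ z).run = some ((h ⬝ᵥ z - δ) / (h ⬝ᵥ h), 4 * n + 4) := by
  have h0 : h ⬝ᵥ h ≠ 0 := fun h0 => hh (dotProduct_self_eq_zero.mp h0)
  simp [stepLength, run_bind, run_dot, run_sub, run_div h0]
  ring

theorem run_combine {n : ℕ} {lam₁ lam₂ : ℝ} (h : lam₁ + lam₂ ≠ 0) (h₁ h₂ : Fin n → ℝ)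
    (δ₁ δ₂ : ℝ) :
    (combine lam₁ lam₂ h₁ δ₁ h₂ δ₂).run =
      some (.hyperplane
        ((lam₁ / (lam₁ + lam₂)) • h₁ + (1 - lam₁ / (lam₁ + lam₂)) • h₂)
        ((lam₁ / (lam₁ + lam₂)) * δ₁ + (1 - lam₁ / (lam₁ + lam₂)) * δ₂), n * 3 + 7) := by
  have hv : ∀ a b : ℝ, (vec fun i => do
      let x ← mul a (h₁ i)
      let y ← mul b (h₂ i)
      Prog.add x y : Prog ℝ (Fin n → ℝ)).run = some (a • h₁ + b • h₂, n * 3) := by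
    intro a b
    refine run_vec _ 3 fun i => ?_
    simp [run_bind, run_mul, run_add]
  simp only [combine, run_bind, run_const, run_add, run_div h, run_sub, run_mul, run_pure,
    Option.bind_some, Option.map_some, hv, Nat.cast_one]
  congr 2; ring

/-- With this `γ`, the vector `h₁ + γ • h₂` is the component of `h₁` orthogonal to `h₂`. Its squared
norm times `h₂ ⬝ᵥ h₂` is the Gram determinant, which `hle` makes nonpositive. -/
theorem opposite_spec {n : ℕ} {h₁ h₂ : Fin n → ℝ} (hh₂ : h₂ ≠ 0)
    (hneg : h₁ ⬝ᵥ h₂ < 0)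
    (hle : (h₁ ⬝ᵥ h₁) * (h₂ ⬝ᵥ h₂) ≤ (h₁ ⬝ᵥ h₂) * (h₁ ⬝ᵥ h₂)) :
    ∃ γ : ℝ, 0 < γ ∧ h₁ = -(γ • h₂) := by
  have hpos : 0 < h₂ ⬝ᵥ h₂ := by
    rw [dotProduct_self_eq_sq]; exact pow_pos (norm_toLp_pos hh₂) 2
  refine ⟨-(h₁ ⬝ᵥ h₂) / (h₂ ⬝ᵥ h₂), div_pos (by linarith) hpos, ?_⟩
  rw [← sub_eq_zero, sub_neg_eq_add, ← dotProduct_self_eq_zero]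
  set γ := -(h₁ ⬝ᵥ h₂) / (h₂ ⬝ᵥ h₂) with hγ
  have e1 : γ * (h₂ ⬝ᵥ h₂) = -(h₁ ⬝ᵥ h₂) := by rw [hγ]; field_simp
  have e2 : (h₁ + γ • h₂) ⬝ᵥ (h₁ + γ • h₂) =
      h₁ ⬝ᵥ h₁ + 2 * γ * (h₁ ⬝ᵥ h₂) + γ * (γ * (h₂ ⬝ᵥ h₂)) := by
    simp only [add_dotProduct, dotProduct_add, smul_dotProduct, dotProduct_smul, smul_eq_mul,
      dotProduct_comm h₂ h₁]
    ring
  have h3 : 0 ≤ (h₁ + γ • h₂) ⬝ᵥ (h₁ + γ • h₂) := by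
    rw [dotProduct_self_eq_sq]; positivity
  refine le_antisymm ?_ h3
  refine le_of_mul_le_mul_right ?_ hpos
  rw [e2, e1]
  nlinarith

/-- A vanishing convex combination of nonzero vectors makes them negative multiples of each other,
and then the test `opposite` succeeds. -/
theorem combination_ne_zero {n : ℕ} {h₁ h₂ : Fin n → ℝ} (hh₁ : h₁ ≠ 0) (hh₂ : h₂ ≠ 0)
    (hopp : ¬(h₁ ⬝ᵥ h₂ < 0 ∧ (h₁ ⬝ᵥ h₁) * (h₂ ⬝ᵥ h₂) ≤ (h₁ ⬝ᵥ h₂) * (h₁ ⬝ᵥ h₂)))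
    {α β : ℝ} (hα : 0 ≤ α) (hβ : 0 ≤ β) (hαβ : α + β = 1) : α • h₁ + β • h₂ ≠ 0 := by
  intro h0
  have hp₂ : 0 < h₂ ⬝ᵥ h₂ := by
    rw [dotProduct_self_eq_sq]; exact pow_pos (norm_toLp_pos hh₂) 2
  rcases hα.eq_or_lt with rfl | hα
  · rw [zero_add] at hαβ
    simp [hαβ, hh₂] at h0
  rcases hβ.eq_or_lt with rfl | hβ
  · rw [add_zero] at hαβ
    simp [hαβ, hh₁] at h0
  have e1 : h₁ = (-(β / α)) • h₂ := by
    have h1 : α • h₁ = -(β • h₂) := eq_neg_of_add_eq_zero_left h0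
    have h2 : h₁ = α⁻¹ • (α • h₁) := by rw [smul_smul, inv_mul_cancel₀ hα.ne', one_smul]
    rw [h2, h1, smul_neg, smul_smul, neg_smul]
    congr 2; ring
  apply hopp
  have hγ : 0 < β / α := div_pos hβ hα
  simp only [e1, smul_dotProduct, dotProduct_smul, smul_eq_mul]
  constructor
  · nlinarith
  · apply le_of_eq; ring

/-- The 9 steps are 5 for the radius test and 4 for the new squared radius, where `25/49 = (5/7)²`.
-/
theorem run_recursion_succ {n l : ℕ} (es : List (Equation ℝ n)) (C : Fin l → Fin n → ℝ)
    (d : Fin l → ℝ) {cmaxsq ε : ℝ} (fuel : ℕ) (z : Fin n → ℝ) {ρ : ℝ}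
    (hlarge : ¬4 * (ρ ^ 2 * cmaxsq) ≤ ε * ε) :
    (recursion es C d cmaxsq ε (fuel + 1) z (ρ ^ 2)).run =
      (recursion es C d cmaxsq ε fuel z ((5 / 7 * ρ) ^ 2)).run.bind fun r =>
        (match r.1 with
          | .solution x => return .solution x
          | .failure => return .failure
          | .hyperplane h₁ δ₁ => do
              let lam₁ ← stepLength h₁ δ₁ z
              let z₀ ← subSmul z lam₁ h₁
              let second ← recursion es C d cmaxsq ε fuel z₀ ((5 / 7 * ρ) ^ 2)
              match second with
              | .solution x => return .solution x
              | .failure => return .failure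
              | .hyperplane h₂ δ₂ =>
                  let fails ← opposite h₁ h₂
                  if fails then return .failure
                  else
                    let lam₂ ← stepLength h₂ δ₂ z₀
                    combine lam₁ lam₂ h₁ δ₁ h₂ δ₂ : Prog ℝ (Outcome ℝ n)).run.map
          fun s => (s.1, 9 + r.2 + s.2) := by
  have hrsq : (25 : ℝ) / 49 * ρ ^ 2 = (5 / 7 * ρ) ^ 2 := by ring
  have h49 : ((49 : ℕ) : ℝ) ≠ 0 := by norm_num
  rw [recursion.eq_def]
  simp only [run_bind, run_smallRadius, Option.bind_some]
  rw [if_neg (by simpa using hlarge)]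
  simp only [run_bind, run_const, run_div h49, run_mul, Option.bind_some]
  simp only [Nat.cast_ofNat, hrsq]
  cases (recursion es C d cmaxsq ε fuel z ((5 / 7 * ρ) ^ 2)).run with
  | none => rfl
  | some r =>
    have harith : ∀ t s : ℕ, 5 + (1 + (1 + (1 + (1 + (t + s))))) = 9 + t + s := by
      intro t s; ring
    obtain ⟨o, t⟩ := r
    rcases o with _ | _ | _ <;>
      simp only [Option.bind_some, Option.map_map, Function.comp_def, harith]
    congr 3; funext lam₁; congr 1; funext z₀; congr 1; funext o
    cases o <;> rfl

/-- For feasible `y`, the first inequality reads `h₂ ⬝ᵥ y ≥ h₂ ⬝ᵥ z` after division by `-γ`, whereas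
the second gives `h₂ ⬝ᵥ y ≤ δ₂ < h₂ ⬝ᵥ z`. -/
theorem feasibleSet_eq_empty_of_opposite {n l : ℕ} {es : List (Equation ℝ n)}
    {C : Fin l → Fin n → ℝ} {d : Fin l → ℝ} {h₁ h₂ z : Fin n → ℝ} {δ₁ δ₂ γ : ℝ}
    (hy₁ : ∀ y ∈ feasibleSet es C d, h₁ ⬝ᵥ y ≤ δ₁) (hy₂ : ∀ y ∈ feasibleSet es C d, h₂ ⬝ᵥ y ≤ δ₂)
    (hz₁ : h₁ ⬝ᵥ z = δ₁) (hz₂ : δ₂ < h₂ ⬝ᵥ z) (hγ : 0 < γ) (hopp : h₁ = -(γ • h₂)) :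
    feasibleSet es C d = ∅ := by
  rw [Set.eq_empty_iff_forall_notMem]
  intro y hy
  have e1 := hy₁ y hy
  have e2 := hy₂ y hy
  rw [← hz₁, hopp, neg_dotProduct, neg_dotProduct, smul_dotProduct, smul_dotProduct, smul_eq_mul,
    smul_eq_mul, neg_le_neg_iff] at e1
  have := le_of_mul_le_mul_left e1 hγ
  linarith

/-- An inner node costs at most `19n + 32` steps besides its two calls. Adding `19n + 36` to the
running time absorbs this: the shifted time at most doubles from one level to the next. Outcome and
time do not depend on the fuel once it reaches `N`. -/
theorem run_recursion {n l : ℕ} {es : List (Equation ℝ n)} (hes : IsOrthogonal es)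
    {C : Fin l → Fin n → ℝ} (hC : ∀ k, C k ≠ 0) (d : Fin l → ℝ) {cmaxsq ε : ℝ}
    (hmax : ∀ k, C k ⬝ᵥ C k ≤ cmaxsq) (hε : 0 ≤ ε) (N : ℕ) (z : Fin n → ℝ) {ρ : ℝ} (hρ : 0 < ρ)
    (hN : 4 * (((5 / 7) ^ N * ρ) ^ 2 * cmaxsq) ≤ ε * ε) :
    ∃ (o : Outcome ℝ n) (t : ℕ),
      (∀ fuel, N ≤ fuel → (recursion es C d cmaxsq ε fuel z (ρ ^ 2)).run = some (o, t)) ∧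
      t + (19 * n + 36) ≤ 2 ^ N *
        (es.length * (4 * n + 3) + l * (4 * n + 8) + (5 * n + 8) + (19 * n + 36)) ∧
      o.IsCorrect es C d ε z ρ := by
  set T := es.length * (4 * n + 3) + l * (4 * n + 8) + (5 * n + 8) + (19 * n + 36) with hT
  -- The radius may become small before the depth `N` is used up, so leaves are treated for every
  -- `N`.
  have hbase : ∀ (N : ℕ) (z : Fin n → ℝ) {ρ : ℝ}, 0 < ρ → 4 * (ρ ^ 2 * cmaxsq) ≤ ε * ε →
      ∃ (o : Outcome ℝ n) (t : ℕ),
        (∀ fuel, N ≤ fuel → (recursion es C d cmaxsq ε fuel z (ρ ^ 2)).run = some (o, t)) ∧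
        t + (19 * n + 36) ≤ 2 ^ N * T ∧ o.IsCorrect es C d ε z ρ := by
    intro N z ρ hρ hsmall
    obtain ⟨o, t, hrun, ht, ho⟩ := run_elementary hes hC d hmax hε z hρ hsmall
    refine ⟨o, 5 + t, fun fuel _ => ?_, ?_, ho⟩
    · rw [recursion.eq_def]
      simp only [run_bind, run_smallRadius, Option.bind_some]
      rw [if_pos (by simpa using hsmall), hrun, Option.map_some]
    · have h1 : T ≤ 2 ^ N * T := Nat.le_mul_of_pos_left _ (by positivity)
      omega
  induction N generalizing z ρ with
  | zero => exact hbase 0 z hρ (by simpa using hN)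
  | succ N ih =>
    by_cases hsmall : 4 * (ρ ^ 2 * cmaxsq) ≤ ε * ε
    · exact hbase _ z hρ hsmall
    have hρ' : 0 < 5 / 7 * ρ := by positivity
    have hN' : 4 * (((5 / 7) ^ N * (5 / 7 * ρ)) ^ 2 * cmaxsq) ≤ ε * ε := by
      rwa [show (5 / 7 : ℝ) ^ N * (5 / 7 * ρ) = (5 / 7) ^ (N + 1) * ρ by ring]
    have hpow : 2 ^ (N + 1) * T = 2 ^ N * T + 2 ^ N * T := by ring
    rw [hpow]
    -- If the first call already ends the search, the unused share of the second call pays for the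
    -- overhead.
    have hT' : 19 * n + 36 ≤ 2 ^ N * T :=
      (by omega : 19 * n + 36 ≤ T).trans (Nat.le_mul_of_pos_left _ (by positivity))
    obtain ⟨o₁, t₁, hrun₁, ht₁, ho₁⟩ := ih z hρ' hN'
    suffices H : ∃ (o : Outcome ℝ n) (t : ℕ),
        (∀ fuel, N ≤ fuel →
          (recursion es C d cmaxsq ε (fuel + 1) z (ρ ^ 2)).run = some (o, t)) ∧
        t + (19 * n + 36) ≤ 2 ^ N * T + 2 ^ N * T ∧ o.IsCorrect es C d ε z ρ by
      obtain ⟨o, t, hrun, h⟩ := H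
      refine ⟨o, t, fun fuel hfuel => ?_, h⟩
      obtain ⟨f, rfl⟩ : ∃ f, fuel = f + 1 := ⟨fuel - 1, by omega⟩
      exact hrun f (by omega)
    rcases o₁ with x | ⟨h₁, δ₁⟩ | _
    · refine ⟨.solution x, 9 + t₁, fun fuel hfuel => ?_, by omega, ho₁⟩
      simp [run_recursion_succ es C d fuel z hsmall, hrun₁ fuel hfuel, run_pure]
    · obtain ⟨hh₁, hy₁, hz₁⟩ := ho₁
      set lam₁ := (h₁ ⬝ᵥ z - δ₁) / (h₁ ⬝ᵥ h₁) with hlam₁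
      set z₀ := z - lam₁ • h₁ with hz₀
      have hz₀h : h₁ ⬝ᵥ z₀ = δ₁ := by
        have h0 : h₁ ⬝ᵥ h₁ ≠ 0 := fun h0 => hh₁ (dotProduct_self_eq_zero.mp h0)
        rw [hz₀, dotProduct_sub, dotProduct_smul, smul_eq_mul, hlam₁, div_mul_cancel₀ _ h0]
        ring
      obtain ⟨o₂, t₂, hrun₂, ht₂, ho₂⟩ := ih z₀ hρ' hN'
      rcases o₂ with x | ⟨h₂, δ₂⟩ | _
      · refine ⟨.solution x, 9 + t₁ + (4 * n + 4 + (n * 2 + t₂)), fun fuel hfuel => ?_, by omega,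
          ho₂⟩
        simp [run_recursion_succ es C d fuel z hsmall, hrun₁ fuel hfuel, run_pure, run_bind,
          run_stepLength hh₁, run_subSmul, ← hlam₁, ← hz₀, hrun₂ fuel hfuel]
      · obtain ⟨hh₂, hy₂, hz₂⟩ := ho₂
        by_cases hopp : h₁ ⬝ᵥ h₂ < 0 ∧ (h₁ ⬝ᵥ h₁) * (h₂ ⬝ᵥ h₂) ≤ (h₁ ⬝ᵥ h₂) * (h₁ ⬝ᵥ h₂)
        · refine ⟨.failure, 9 + t₁ + (4 * n + 4 + (n * 2 + (t₂ + (6 * n + 8)))),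
            fun fuel hfuel => ?_, by omega, ?_⟩
          · simp [run_recursion_succ es C d fuel z hsmall, hrun₁ fuel hfuel, run_pure, run_bind,
              run_stepLength hh₁, run_subSmul, ← hlam₁, ← hz₀, hrun₂ fuel hfuel, run_opposite, hopp]
          · obtain ⟨γ, hγ, hγh⟩ := opposite_spec hh₂ hopp.1 hopp.2
            have := mul_pos hρ' (norm_toLp_pos hh₂)
            exact feasibleSet_eq_empty_of_opposite hy₁ hy₂ hz₀h (by linarith) hγ hγh
        · set lam₂ := (h₂ ⬝ᵥ z₀ - δ₂) / (h₂ ⬝ᵥ h₂) with hlam₂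
          have hpos : ∀ {h x : Fin n → ℝ} {δ : ℝ}, h ≠ 0 →
              5 / 7 * ρ * ‖WithLp.toLp 2 h‖ ≤ h ⬝ᵥ x - δ → 0 < (h ⬝ᵥ x - δ) / (h ⬝ᵥ h) := by
            intro h x δ hh hx
            have h1 := norm_toLp_pos hh
            rw [dotProduct_self_eq_sq h]
            exact div_pos ((mul_pos hρ' h1).trans_le hx) (pow_pos h1 2)
          have hlam₁pos : 0 < lam₁ := hpos hh₁ hz₁
          have hlam₂pos : 0 < lam₂ := hpos hh₂ hz₂
          have hsum : lam₁ + lam₂ ≠ 0 := by positivity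
          obtain ⟨hα0, hα1, hfar⟩ := combination_far (WithLp.toLp 2 h₁) (WithLp.toLp 2 h₂)
            (WithLp.toLp 2 z) (WithLp.toLp 2 z₀) δ₁ δ₂ ρ lam₁ lam₂ _ hρ
            (norm_pos_iff.mp (norm_toLp_pos hh₁)) (norm_pos_iff.mp (norm_toLp_pos hh₂))
            (by simp only [← dotProduct_eq_inner]; exact hlam₁)
            (by rw [hz₀, WithLp.toLp_sub, WithLp.toLp_smul])
            (by simp only [← dotProduct_eq_inner]; exact hlam₂)
            (by rw [← dotProduct_eq_inner]; linarith)
            (by rw [← dotProduct_eq_inner]; linarith) rfl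
          rw [← WithLp.toLp_smul, ← WithLp.toLp_smul, ← WithLp.toLp_add,
            ← dotProduct_eq_inner] at hfar
          refine ⟨.hyperplane _ _, 9 + t₁ + (4 * n + 4 + (n * 2 + (t₂ + (6 * n + 8 +
            (4 * n + 4 + (n * 3 + 7)))))), fun fuel hfuel => ?_, by omega,
            combination_ne_zero hh₁ hh₂ hopp hα0 (sub_nonneg.mpr hα1) (by ring),
            fun y hy => ?_, hfar⟩
          · simp only [run_recursion_succ es C d fuel z hsmall, hrun₁ fuel hfuel, run_bind,
              run_stepLength hh₁, run_subSmul, ← hlam₁, ← hz₀, hrun₂ fuel hfuel, run_opposite, hopp,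
              run_stepLength hh₂, ← hlam₂, run_combine hsum, Option.bind_some, Option.map_some,
              decide_false, Bool.false_eq_true, if_false]
          · rw [add_dotProduct, smul_dotProduct, smul_dotProduct, smul_eq_mul, smul_eq_mul]
            exact add_le_add (mul_le_mul_of_nonneg_left (hy₁ y hy) hα0)
              (mul_le_mul_of_nonneg_left (hy₂ y hy) (sub_nonneg.mpr hα1))
      · refine ⟨.failure, 9 + t₁ + (4 * n + 4 + (n * 2 + t₂)), fun fuel hfuel => ?_, by omega, ho₂⟩
        simp [run_recursion_succ es C d fuel z hsmall, hrun₁ fuel hfuel, run_pure, run_bind,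
          run_stepLength hh₁, run_subSmul, ← hlam₁, ← hz₀, hrun₂ fuel hfuel]
    · refine ⟨.failure, 9 + t₁, fun fuel hfuel => ?_, by omega, ho₁⟩
      simp [run_recursion_succ es C d fuel z hsmall, hrun₁ fuel hfuel, run_pure]

/-! ## Basic feasible solutions -/

/-- The columns in `S` extend to a basis of the column space, which is all of `ℝ^m` by the rank
hypothesis. Listing the basis in increasing order gives a submatrix of the kind counted by
`maxSubdet`. -/
theorem exists_submatrix_det_ne_zero {m n : ℕ} (A : Matrix (Fin m) (Fin n) ℤ)
    (hA : (A.map (Int.cast : ℤ → ℝ)).rank = m) {S : Set (Fin n)}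
    (hS : LinearIndepOn ℝ (A.map (Int.cast : ℤ → ℝ)).col S) :
    ∃ f : Fin m ↪o Fin n, S ⊆ Set.range f ∧ (A.submatrix id f).det ≠ 0 := by
  classical
  set M := A.map (Int.cast : ℤ → ℝ) with hM
  set B := hS.extend (Set.subset_univ S) with hB
  have hBi : LinearIndepOn ℝ M.col B := hS.linearIndepOn_extend _
  have hspan : Submodule.span ℝ (M.col '' B) = ⊤ := by
    rw [hB, hS.span_image_extend_eq_span_image, Set.image_univ]
    apply Submodule.eq_top_of_finrank_eq
    rw [← Matrix.rank_eq_finrank_span_cols, hA, Module.finrank_fin_fun]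
  have hcard : B.toFinset.card = m := by
    have h1 := finrank_span_eq_card hBi
    rw [← Set.image_eq_range, hspan, finrank_top, Module.finrank_fin_fun] at h1
    rw [Set.toFinset_card, ← h1]
  set f := B.toFinset.orderEmbOfFin hcard with hf
  have hrange : Set.range f = B := by
    rw [hf, Finset.range_orderEmbOfFin, Set.coe_toFinset]
  refine ⟨f, by rw [hrange]; exact hS.subset_extend _, ?_⟩
  have hli : LinearIndependent ℝ ((A.submatrix id f).map (Int.cast : ℤ → ℝ)).col := by
    have h2 : LinearIndependent ℝ (fun k : Fin m => M.col (f k)) :=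
      hBi.comp (fun k => ⟨f k, hrange ▸ Set.mem_range_self k⟩) fun a b h => by
        simpa using h
    exact h2
  have hu := (Matrix.isUnit_iff_isUnit_det _).mp (Matrix.linearIndependent_cols_iff_isUnit.mp hli)
  intro h0
  have h3 : ((A.submatrix id f).map (Int.cast : ℤ → ℝ)).det = ((A.submatrix id f).det : ℝ) :=
    ((Int.castRingHom ℝ).map_det _).symm
  rw [h3, h0] at hu
  simp at hu

theorem natAbs_det_le_maxSubdet {m n : ℕ} (A : Matrix (Fin m) (Fin n) ℤ) (f : Fin m ↪o Fin n) :
    (A.submatrix id f).det.natAbs ≤ maxSubdet A :=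
  Finset.le_sup (f := fun f : Fin m ↪o Fin n => (A.submatrix id f).det.natAbs) (Finset.mem_univ f)

theorem one_le_maxSubdet {m n : ℕ} {A : Matrix (Fin m) (Fin n) ℤ}
    (hA : (A.map (Int.cast : ℤ → ℝ)).rank = m) : 1 ≤ maxSubdet A := by
  obtain ⟨f, -, hf⟩ := exists_submatrix_det_ne_zero A hA (linearIndepOn_empty ℝ _)
  exact (Nat.one_le_iff_ne_zero.mpr (Int.natAbs_ne_zero.mpr hf)).trans
    (natAbs_det_le_maxSubdet A f)

/-- Cramer's rule: for a nonsingular submatrix `N` whose columns contain the support, `det N * x i`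
is an entry of the integer vector `adj N * b`. It is nonzero, hence at least 1 in absolute value. -/
theorem one_le_maxSubdet_mul_of_basic {m n : ℕ} {A : Matrix (Fin m) (Fin n) ℤ} {b : Fin m → ℤ}
    (hA : (A.map (Int.cast : ℤ → ℝ)).rank = m) {x : Fin n → ℝ} (hx : x ∈ feasibleRegion A b)
    (hS : LinearIndepOn ℝ (A.map (Int.cast : ℤ → ℝ)).col {j | x j ≠ 0}) {i : Fin n}
    (hi : 0 < x i) : 1 ≤ maxSubdet A * x i := by
  obtain ⟨f, hSf, hdet⟩ := exists_submatrix_det_ne_zero A hA hS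
  obtain ⟨k, rfl⟩ := hSf (show i ∈ {j | x j ≠ 0} from hi.ne')
  set N := A.submatrix id f with hN
  have hNx : (N.map (Int.cast : ℤ → ℝ)).mulVec (x ∘ f) = fun j => (b j : ℝ) := by
    rw [← hx.1]
    funext j
    simp only [Matrix.mulVec, dotProduct, Matrix.map_apply, hN, Matrix.submatrix_apply, id,
      Function.comp_apply]
    refine Finset.sum_of_injOn f f.injective.injOn (by simp) (fun l _ hl => ?_) (fun _ _ => rfl)
    have : x l = 0 := by
      by_contra h
      obtain ⟨l', rfl⟩ := hSf h
      exact hl ⟨l', by simp, rfl⟩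
    rw [this, mul_zero]
  have hcr : (N.det : ℝ) * x (f k) = ((N.adjugate.mulVec b k : ℤ) : ℝ) := by
    have h1 : (N.map (Int.cast : ℤ → ℝ)).adjugate.mulVec (fun j => (b j : ℝ)) =
        (N.map (Int.cast : ℤ → ℝ)).det • (x ∘ f) := by
      rw [← hNx, Matrix.mulVec_mulVec, Matrix.adjugate_mul, Matrix.smul_mulVec, Matrix.one_mulVec]
    have h2 : (N.map (Int.cast : ℤ → ℝ)).det = (N.det : ℝ) :=
      ((Int.castRingHom ℝ).map_det _).symm
    have h3 : (N.map (Int.cast : ℤ → ℝ)).adjugate = N.adjugate.map (Int.cast : ℤ → ℝ) :=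
      ((Int.castRingHom ℝ).map_adjugate _).symm
    have h4 := congrFun h1 k
    rw [h2, h3] at h4
    simp only [Pi.smul_apply, smul_eq_mul, Function.comp_apply] at h4
    rw [← h4]
    simp [Matrix.mulVec, dotProduct]
  have h1 : (1 : ℝ) ≤ |(N.det : ℝ)| * x (f k) := by
    rw [← abs_of_pos hi, ← abs_mul, hcr]
    have h2 : N.adjugate.mulVec b k ≠ 0 := by
      intro h0
      rw [h0, Int.cast_zero, mul_eq_zero] at hcr
      rcases hcr with h | h
      · exact hdet (by exact_mod_cast h)
      · exact hi.ne' h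
    exact_mod_cast Int.one_le_abs h2
  have h2 : |(N.det : ℝ)| ≤ maxSubdet A := by
    rw [← Int.cast_abs, Int.abs_eq_natAbs, Int.cast_natCast]
    exact_mod_cast natAbs_det_le_maxSubdet A f
  exact h1.trans (mul_le_mul_of_nonneg_right h2 hi.le)

theorem abs_apply_le_norm_toLp {n : ℕ} (x : Fin n → ℝ) (i : Fin n) :
    |x i| ≤ ‖WithLp.toLp 2 x‖ :=
  PiLp.norm_apply_le (WithLp.toLp 2 x) i

/-- The ratio test of the simplex method: move along `w` until a first coordinate vanishes.
Coordinate `i` stays positive because `w i` is nonnegative. -/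
theorem exists_feasible_support_ssubset {m n : ℕ} {A : Matrix (Fin m) (Fin n) ℤ} {b : Fin m → ℤ}
    {r : ℝ} (hr : ∀ x ∈ feasibleRegion A b, ‖WithLp.toLp 2 x‖ < r) {x w : Fin n → ℝ}
    (hx : x ∈ feasibleRegion A b) (hw : (A.map (Int.cast : ℤ → ℝ)).mulVec w = 0) (hw0 : w ≠ 0)
    (hsupp : ∀ j, x j = 0 → w j = 0) {i : Fin n} (hi : 0 < x i) (hwi : 0 ≤ w i) :
    ∃ y ∈ feasibleRegion A b, 0 < y i ∧ {j | y j ≠ 0} ⊂ {j | x j ≠ 0} := by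
  have hx0 : ∀ j, 0 ≤ x j := fun j => by linarith [hx.2 j]
  have hmem : ∀ s : ℝ, (∀ j, 0 ≤ x j + s * w j) → x + s • w ∈ feasibleRegion A b := by
    intro s hs
    refine ⟨by rw [Matrix.mulVec_add, Matrix.mulVec_smul, hw, smul_zero, add_zero]; exact hx.1,
      fun j => ?_⟩
    have := hs j
    simp only [Pi.add_apply, Pi.smul_apply, smul_eq_mul]
    linarith
  have hr0 : 0 < r := (norm_nonneg _).trans_lt (hr x hx)
  have hneg : ∃ j, w j < 0 := by
    by_contra! h
    obtain ⟨j, hj⟩ := Function.ne_iff.mp hw0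
    have hj : 0 < w j := (h j).lt_of_ne' hj
    -- If `w` had no negative entry, a step of length `r / w j` would stay feasible and raise
    -- coordinate `j` to at least `r`, against the bound on the region.
    have h1 := hr _ (hmem (r / w j) fun l =>
      add_nonneg (hx0 l) (mul_nonneg (div_pos hr0 hj).le (h l)))
    have h2 := abs_apply_le_norm_toLp (x + (r / w j) • w) j
    have h3 := le_abs_self ((x + (r / w j) • w) j)
    simp only [Pi.add_apply, Pi.smul_apply, smul_eq_mul, div_mul_cancel₀ _ hj.ne'] at h2 h3
    linarith [hx0 j]
  obtain ⟨j, hj, hmin⟩ := Finset.exists_min_image (Finset.univ.filter fun j => w j < 0)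
    (fun j => x j / -w j) (by obtain ⟨j, hj⟩ := hneg; exact ⟨j, by simpa using hj⟩)
  simp only [Finset.mem_filter, Finset.mem_univ, true_and] at hj hmin
  set s := x j / -w j with hs
  have hs0 : 0 ≤ s := div_nonneg (hx0 j) (by linarith)
  refine ⟨x + s • w, hmem s fun l => ?_, ?_, ?_, fun hsub => ?_⟩
  · rcases le_or_gt 0 (w l) with hl | hl
    · exact add_nonneg (hx0 l) (mul_nonneg hs0 hl)
    · have := (le_div_iff₀ (by linarith)).mp (hmin l hl)
      linarith
  · exact add_pos_of_pos_of_nonneg hi (mul_nonneg hs0 hwi)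
  · intro l hl h0
    exact hl (by simp [h0, hsupp l h0])
  · refine hsub (show x j ≠ 0 from fun h => hj.ne (hsupp j h)) ?_
    have : -w j ≠ 0 := by linarith
    have h1 : s * -w j = x j := div_mul_cancel₀ _ this
    simp only [Pi.add_apply, Pi.smul_apply, smul_eq_mul]
    linarith

theorem exists_basic_feasible {m n : ℕ} {A : Matrix (Fin m) (Fin n) ℤ} {b : Fin m → ℤ}
    {r : ℝ} (hr : ∀ x ∈ feasibleRegion A b, ‖WithLp.toLp 2 x‖ < r) {x : Fin n → ℝ}
    (hx : x ∈ feasibleRegion A b) {i : Fin n} (hi : 0 < x i) :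
    ∃ y ∈ feasibleRegion A b, 0 < y i ∧
      LinearIndepOn ℝ (A.map (Int.cast : ℤ → ℝ)).col {j | y j ≠ 0} := by
  classical
  induction hk : ({j | x j ≠ 0} : Set (Fin n)).ncard using Nat.strong_induction_on
    generalizing x with
  | _ k ih =>
    by_cases hli : LinearIndepOn ℝ (A.map (Int.cast : ℤ → ℝ)).col {j | x j ≠ 0}
    · exact ⟨x, hx, hi, hli⟩
    suffices H : ∃ w : Fin n → ℝ, (A.map (Int.cast : ℤ → ℝ)).mulVec w = 0 ∧ w ≠ 0 ∧
        (∀ j, x j = 0 → w j = 0) by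
      obtain ⟨w, hw, hw0, hsupp⟩ := H
      -- The sign of `w` is free; it is chosen so that coordinate `i` does not decrease.
      have hsmaller : ∃ y ∈ feasibleRegion A b, 0 < y i ∧ {j | y j ≠ 0} ⊂ {j | x j ≠ 0} := by
        rcases le_total 0 (w i) with h | h
        · exact exists_feasible_support_ssubset hr hx hw hw0 hsupp hi h
        · exact exists_feasible_support_ssubset hr hx (w := -w)
            (by rw [Matrix.mulVec_neg, hw, neg_zero]) (neg_ne_zero.mpr hw0)
            (fun j hj => by simp [hsupp j hj]) hi (by simpa using h)
      obtain ⟨y, hy, hyi, hsub⟩ := hsmaller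
      exact ih _ (hk ▸ Set.ncard_lt_ncard hsub (Set.toFinite _)) hy hyi rfl
    have hcoe : ({j | x j ≠ 0} : Set (Fin n)) =
        ((Finset.univ.filter fun j => x j ≠ 0 : Finset (Fin n)) : Set (Fin n)) := by
      ext j; simp
    rw [hcoe, linearIndepOn_finset_iff] at hli
    push Not at hli
    obtain ⟨f, hf, j, hj, hfj⟩ := hli
    refine ⟨fun l => if x l ≠ 0 then f l else 0, ?_, ?_, fun l hl => by simp [hl]⟩
    · rw [Matrix.mulVec_eq_sum, ← hf, Finset.sum_filter]
      refine Finset.sum_congr rfl fun l _ => ?_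
      split_ifs with h
      · funext k
        simp [mul_comm]
      · simp
    · refine Function.ne_iff.mpr ⟨j, ?_⟩
      have : x j ≠ 0 := by simpa using hj
      simpa [this] using hfj

/-- Coordinate `j` of the average of the basic solutions `v i` is at least `v j j / n`, as all
entries are nonnegative. -/
theorem exists_feasible_coordinates_large {m n : ℕ} {A : Matrix (Fin m) (Fin n) ℤ}
    {b : Fin m → ℤ} (hn : 0 < n) (hA : (A.map (Int.cast : ℤ → ℝ)).rank = m) {r : ℝ}
    (hr : ∀ x ∈ feasibleRegion A b, ‖WithLp.toLp 2 x‖ < r) {x : Fin n → ℝ}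
    (hx : x ∈ feasibleRegion A b) (hpos : ∀ i, 0 < x i) :
    ∃ y ∈ feasibleRegion A b, ∀ i, 1 ≤ n * maxSubdet A * y i := by
  choose v hv hvi hli using fun i => exists_basic_feasible hr hx (hpos i)
  have hn' : (n : ℝ) ≠ 0 := by exact_mod_cast hn.ne'
  have hn0 : (0 : ℝ) ≤ (n : ℝ)⁻¹ := by positivity
  have hv0 : ∀ i j, 0 ≤ v i j := fun i j => by linarith [(hv i).2 j]
  refine ⟨(n : ℝ)⁻¹ • ∑ i, v i, ⟨?_, fun j => ?_⟩, fun j => ?_⟩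
  · rw [Matrix.mulVec_smul, Matrix.mulVec_sum]
    funext k
    simp [(hv _).1, hn']
  · have : 0 ≤ (n : ℝ)⁻¹ * ∑ i, v i j :=
      mul_nonneg hn0 (Finset.sum_nonneg fun i _ => hv0 i j)
    simpa using this
  · have h1 := one_le_maxSubdet_mul_of_basic hA (hv j) (hli j) (hvi j)
    have h2 : v j j ≤ ∑ i, v i j :=
      Finset.single_le_sum (f := fun i => v i j) (fun i _ => hv0 i j) (Finset.mem_univ j)
    simp only [Pi.smul_apply, Finset.sum_apply, smul_eq_mul]
    calc (1 : ℝ) ≤ maxSubdet A * v j j := h1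
      _ ≤ maxSubdet A * ∑ i, v i j := by gcongr
      _ = _ := by field_simp

/-! ## The LFS algorithm -/

/-- For rows of norm one the computed `cmaxsq` is at most 1, so it disappears from the depth
condition. -/
theorem run_divideAndConquer {m n l : ℕ} (A : Fin m → Fin n → ℝ) (b : Fin m → ℝ)
    (hA : LinearIndependent ℝ A) {C : Fin l → Fin n → ℝ} (hC : ∀ k, C k ⬝ᵥ C k = 1)
    (d : Fin l → ℝ) {ε : ℝ} (hε : 0 ≤ ε) (N : ℕ) (z : Fin n → ℝ) {ρ : ℝ} (hρ : 0 < ρ)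
    (hN : 4 * ((5 / 7) ^ N * ρ) ^ 2 ≤ ε * ε) :
    ∃ (es : List (Equation ℝ n)) (o : Outcome ℝ n) (t : ℕ),
      solutions es = {y | ∀ i, A i ⬝ᵥ y = b i} ∧
      (∀ fuel, N ≤ fuel → (divideAndConquer fuel A b C d z (ρ ^ 2) ε).run = some (o, t)) ∧
      t ≤ m * (m * (4 * n + 4) + (2 * n + 1)) + (l * (2 * n + 2) + 1) + 2 ^ N *
        (m * (4 * n + 3) + l * (4 * n + 8) + (5 * n + 8) + (19 * n + 36)) ∧
      o.IsCorrect es C d ε z ρ := by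
  obtain ⟨es, t₁, hrun₁, ht₁, hlen, hes, hsol⟩ := run_orthogonalize [] ⟨List.Pairwise.nil, by simp⟩
    ⊥ (by simp) A b fun c hc =>
      funext (Fintype.linearIndependent_iff.mp hA c ((Submodule.mem_bot ℝ).mp hc))
  obtain ⟨v, hrun₂, -, hCv, hv⟩ := run_maxNormSq (0 : ℝ) C
  have hv1 : v ≤ 1 := hv 1 zero_le_one fun k => (hC k).le
  obtain ⟨o, t₃, hrun₃, ht₃, ho⟩ := run_recursion hes
    (fun k h0 => by simpa [h0] using hC k) d hCv hε N z hρ (by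
      refine le_trans ?_ hN
      have : ((5 / 7) ^ N * ρ) ^ 2 * v ≤ ((5 / 7) ^ N * ρ) ^ 2 :=
        mul_le_of_le_one_right (sq_nonneg _) hv1
      linarith)
  refine ⟨es, o, t₁ + (1 + (l * (2 * n + 2) + t₃)), by simpa [solutions] using hsol,
    fun fuel hfuel => ?_, ?_, ho⟩
  · simp only [divideAndConquer, run_bind, hrun₁, run_const, Nat.cast_zero, hrun₂,
      hrun₃ fuel hfuel, Option.bind_some, Option.map_some]
  · simp only [List.length_nil, zero_add] at ht₁ hlen
    rw [hlen] at ht₃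
    omega

theorem exists_pow_depth {ρ : ℝ} (hρ : 1 ≤ ρ) :
    ∃ N : ℕ, 2 * ρ ≤ (7 / 5) ^ N ∧
      (2 : ℝ) ^ N ≤ 2 * 2 ^ (1 / Real.logb 2 (7 / 5)) * ρ ^ (1 / Real.logb 2 (7 / 5)) := by
  set e := 1 / Real.logb 2 (7 / 5) with he
  have h2 : 0 < Real.log 2 := Real.log_pos (by norm_num)
  have h75 : 0 < Real.log (7 / 5) := Real.log_pos (by norm_num)
  have hlog : 0 ≤ Real.log (2 * ρ) := Real.log_nonneg (by linarith)
  set x := Real.log (2 * ρ) / Real.log (7 / 5) with hx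
  have hx0 : 0 ≤ x := div_nonneg hlog h75.le
  refine ⟨⌈x⌉₊, ?_, ?_⟩
  · rw [← Real.log_le_log_iff (by linarith) (by positivity), Real.log_pow, ← div_le_iff₀ h75]
    exact Nat.le_ceil x
  -- Both sides have the logarithm `log 2 * log (2ρ) / log (7/5)`; rounding `x` up then costs a
  -- factor of at most 2.
  · have h1 : (2 : ℝ) ^ x = (2 * ρ) ^ e := by
      rw [Real.rpow_def_of_pos (by norm_num), Real.rpow_def_of_pos (by linarith), hx, he,
        Real.logb]
      congr 1
      field_simp
    calc (2 : ℝ) ^ ⌈x⌉₊ = (2 : ℝ) ^ ((⌈x⌉₊ : ℕ) : ℝ) := (Real.rpow_natCast _ _).symm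
      _ ≤ (2 : ℝ) ^ (x + 1) :=
        Real.rpow_le_rpow_of_exponent_le (by norm_num) (Nat.ceil_lt_add_one hx0).le
      _ = 2 * (2 * ρ) ^ e := by
        rw [Real.rpow_add (by norm_num), Real.rpow_one, h1, mul_comm]
      _ = _ := by rw [Real.mul_rpow (by norm_num) (by linarith), mul_assoc]

theorem snoc_dotProduct {n : ℕ} (a : Fin n → ℝ) (α : ℝ) (y : Fin (n + 1) → ℝ) :
    (Fin.snoc a α : Fin (n + 1) → ℝ) ⬝ᵥ y =
      a ⬝ᵥ (fun i => y i.castSucc) + α * y (Fin.last n) := by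
  simp [dotProduct, Fin.sum_univ_castSucc]

theorem linearIndependent_snoc {m n : ℕ} {A : Matrix (Fin m) (Fin n) ℝ} (hA : A.rank = m)
    (b : Fin m → ℝ) :
    LinearIndependent ℝ (fun i => (Fin.snoc (A i) (b i) : Fin (n + 1) → ℝ)) := by
  have h1 : LinearIndependent ℝ A.row := by
    rw [linearIndependent_iff_card_eq_finrank_span, Fintype.card_fin]
    rw [Matrix.rank_eq_finrank_span_row] at hA
    exact hA.symm
  rw [Fintype.linearIndependent_iff] at h1 ⊢
  intro c hc
  refine h1 c (funext fun j => ?_)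
  simpa using congrFun hc j.castSucc

/-- The rows of the inequalities of the LFS algorithm are the negated unit vectors. -/
theorem neg_unit_dotProduct {n : ℕ} (k : Fin n) (y : Fin n → ℝ) :
    (fun j => if k = j then (-1 : ℝ) else 0) ⬝ᵥ y = -y k := by
  simp [dotProduct]

theorem homogenize_mem {m n : ℕ} {A : Matrix (Fin m) (Fin n) ℤ} {b : Fin m → ℤ}
    {y : Fin (n + 1) → ℝ}
    (hy : ∀ i, (Fin.snoc (fun j => (A i j : ℝ)) (-(b i : ℝ)) : Fin (n + 1) → ℝ) ⬝ᵥ y = 0)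
    (hpos : ∀ i, 0 ≤ y (Fin.castSucc i)) (ht : 0 < y (Fin.last n)) :
    (fun i => y (Fin.castSucc i) / y (Fin.last n)) ∈ feasibleRegion A b := by
  refine ⟨?_, fun i => neg_nonpos.mpr (div_nonneg (hpos i) ht.le)⟩
  funext i
  have h1 := hy i
  rw [snoc_dotProduct] at h1
  have h2 : (fun i => y (Fin.castSucc i) / y (Fin.last n)) =
      (y (Fin.last n))⁻¹ • fun i => y (Fin.castSucc i) := by
    funext i; simp [div_eq_inv_mul]
  rw [h2, Matrix.mulVec_smul]
  have h3 : (A.map (Int.cast : ℤ → ℝ)).mulVec (fun i => y (Fin.castSucc i)) i =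
      b i * y (Fin.last n) := by
    change (fun j => (A i j : ℝ)) ⬝ᵥ _ = _
    linarith
  rw [Pi.smul_apply, h3, smul_eq_mul]
  field_simp

theorem norm_snoc_sq {n : ℕ} (x : Fin n → ℝ) (t : ℝ) :
    ‖WithLp.toLp 2 (Fin.snoc x t : Fin (n + 1) → ℝ)‖ ^ 2 = ‖WithLp.toLp 2 x‖ ^ 2 + t ^ 2 := by
  rw [← dotProduct_self_eq_sq, snoc_dotProduct, ← dotProduct_self_eq_sq]
  simp [pow_two]

/-- The number of steps of the LFS algorithm, bounded through the depth `N` of the recursion. -/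
theorem lfs_steps_le {m n N : ℕ} (hn : 0 < n) (hmn : m ≤ n) {t : ℕ}
    (ht : t ≤ m * (m * (4 * (n + 1) + 4) + (2 * (n + 1) + 1)) +
      ((n + 1) * (2 * (n + 1) + 2) + 1) + 2 ^ N * (m * (4 * (n + 1) + 3) +
      (n + 1) * (4 * (n + 1) + 8) + (5 * (n + 1) + 8) + (19 * (n + 1) + 36))) :
    14 + 2 * m + t + n ≤ 12 * (m ^ 2 * n) + 5 * (n ^ 2 * m) + 2 ^ N * (165 * n ^ 2) := by
  have hn2 : n ≤ n ^ 2 := Nat.le_self_pow (by norm_num) n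
  have hmn2 : m * n ≤ n ^ 2 := by rw [pow_two]; gcongr
  have hmn3 : m * n ≤ n ^ 2 * m := by rw [mul_comm]; gcongr
  have hm2 : m ^ 2 ≤ m ^ 2 * n := Nat.le_mul_of_pos_right _ hn
  have hm : m ≤ m * n := Nat.le_mul_of_pos_right _ hn
  have h1 : m * (m * (4 * (n + 1) + 4) + (2 * (n + 1) + 1)) ≤
      12 * (m ^ 2 * n) + 5 * (n ^ 2 * m) := by
    calc _ = 4 * (m ^ 2 * n) + 8 * m ^ 2 + 2 * (m * n) + 3 * m := by ring
      _ ≤ _ := by omega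
  have h2 : m * (4 * (n + 1) + 3) + (n + 1) * (4 * (n + 1) + 8) + (5 * (n + 1) + 8) +
      (19 * (n + 1) + 36) ≤ 135 * n ^ 2 := by
    calc _ = 4 * (m * n) + 7 * m + 4 * n ^ 2 + 40 * n + 80 := by ring
      _ ≤ _ := by omega
  have h3 : 14 + 2 * m + ((n + 1) * (2 * (n + 1) + 2) + 1) + n ≤ 30 * n ^ 2 := by
    calc _ = 2 * n ^ 2 + 7 * n + 2 * m + 19 := by ring
      _ ≤ _ := by omega
  -- The steps outside the recursion that are of order `n²` are charged to its leaves.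
  have h4 : 30 * n ^ 2 ≤ 2 ^ N * (30 * n ^ 2) := Nat.le_mul_of_pos_left _ (by positivity)
  have h5 := Nat.mul_le_mul_left (2 ^ N) h2
  have h6 : 2 ^ N * (165 * n ^ 2) = 2 ^ N * (135 * n ^ 2) + 2 ^ N * (30 * n ^ 2) := by ring
  omega

theorem run_lfs {m n : ℕ} {A : Matrix (Fin m) (Fin n) ℤ} {b : Fin m → ℤ} {r : ℝ} (hn : 0 < n)
    (hA : (A.map (Int.cast : ℤ → ℝ)).rank = m)
    (hbd : ∀ x ∈ feasibleRegion A b, ‖WithLp.toLp 2 x‖ < r)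
    (hint : feasibleRegion A b = ∅ ∨ ∃ x ∈ feasibleRegion A b, ∀ i, 0 < x i) (N : ℕ)
    (hN : 2 * (2 * n * (maxSubdet A : ℝ) * Real.sqrt (r ^ 2 + 1)) ≤ (7 / 5) ^ N) :
    ∃ (result : Option (Fin n → ℝ)) (time : ℕ),
      (∀ fuel, N ≤ fuel → (lfs fuel (fun i j => (A i j : ℝ)) (fun i => (b i : ℝ))
        (maxSubdet A : ℝ) r).run = some (result, time)) ∧
      (∀ x, result = some x → x ∈ feasibleRegion A b) ∧
      (result = none → feasibleRegion A b = ∅) ∧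
      time ≤ 12 * (m ^ 2 * n) + 5 * (n ^ 2 * m) + 2 ^ N * (165 * n ^ 2) := by
  set ρ := 2 * n * (maxSubdet A : ℝ) * Real.sqrt (r ^ 2 + 1) with hρdef
  have hn1 : (1 : ℝ) ≤ n := by exact_mod_cast hn
  have hΔ : (1 : ℝ) ≤ maxSubdet A := by exact_mod_cast one_le_maxSubdet hA
  have hsqrt : 0 < Real.sqrt (r ^ 2 + 1) := Real.sqrt_pos.mpr (by positivity)
  have hρ : 0 < ρ := by positivity
  have hmn : m ≤ n := by
    have := (A.map (Int.cast : ℤ → ℝ)).rank_le_width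
    omega
  set C : Fin (n + 1) → Fin (n + 1) → ℝ := fun k j => if k = j then (-1 : ℝ) else 0 with hC
  set d : Fin (n + 1) → ℝ := Fin.snoc (fun _ => (-1 : ℝ)) (-2) with hd
  obtain ⟨es, o, t, hes, hrun, ht, ho⟩ := run_divideAndConquer
    (fun i => (Fin.snoc (fun j => (A i j : ℝ)) (-(b i : ℝ)) : Fin (n + 1) → ℝ)) (fun _ => 0)
    (linearIndependent_snoc hA fun i => -(b i : ℝ)) (C := C)
    (fun k => by rw [hC, neg_unit_dotProduct]; simp) d zero_le_one N (fun _ => 0) hρ (by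
      have h1 : (5 / 7 : ℝ) ^ N * (7 / 5) ^ N = 1 := by rw [← mul_pow]; norm_num
      have h2 : 2 * ((5 / 7) ^ N * ρ) ≤ 1 := by
        rw [← h1]
        have : (5 / 7 : ℝ) ^ N * (2 * ρ) ≤ (5 / 7) ^ N * (7 / 5) ^ N := by gcongr
        linarith
      have h3 : 0 ≤ 2 * ((5 / 7) ^ N * ρ) := by positivity
      nlinarith)
  have hsteps := lfs_steps_le hn hmn ht
  have hrad : 2 * (n : ℝ) * maxSubdet A * (2 * (n : ℝ) * maxSubdet A) * (r * r + 1) = ρ ^ 2 := by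
    rw [hρdef, mul_pow, Real.sq_sqrt (by positivity)]; ring
  have hlfs : ∀ fuel, N ≤ fuel → ∀ result s,
      (match o with
        | .solution y => (do
            let x ← vec (fun i => Prog.div (y (Fin.castSucc i)) (y (Fin.last n)))
            return some x : Prog ℝ (Option (Fin n → ℝ)))
        | .hyperplane _ _ => return none
        | .failure => return none).run = some (result, s) →
      (lfs fuel (fun i j => (A i j : ℝ)) (fun i => (b i : ℝ)) (maxSubdet A : ℝ) r).run =
        some (result, 14 + 2 * m + t + s) := by
    intro fuel hfuel result s hs
    have hneg : ∀ i : Fin m, (Prog.neg (b i : ℝ)).run = some (-(b i : ℝ), 2) :=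
      fun i => run_neg _
    have harith : ∀ s : ℕ, 1 + (1 + (1 + (2 + (2 + (m * 2 + (1 + (1 + (1 + (1 + (1 + (1 + (1 +
        (t + s))))))))))))) = 14 + 2 * m + t + s := by
      intro s; ring
    simp only [lfs, run_bind, run_const, run_neg, run_vec _ 2 hneg, run_mul, run_add, Nat.cast_zero,
      Nat.cast_one, Nat.cast_ofNat, Option.bind_some, hrad]
    rw [hrun fuel hfuel]
    rcases o with _ | _ | _ <;> simp only [Option.bind_some] <;> rw [hs] <;>
      simp only [Option.map_some, harith]
  -- Both negative outcomes reduce to this: if every homogenized solution is at distance at least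
  -- `ρ` from the origin, `(τ • y, τ)` cannot exist, so neither can a positive point of the region.
  have hempty : (∀ u ∈ feasibleSet es C d, ρ ≤ ‖WithLp.toLp 2 u‖) → feasibleRegion A b = ∅ := by
    intro hfar
    rcases hint with h | ⟨x, hx, hpos⟩
    · exact h
    obtain ⟨y, hy, hy1⟩ := exists_feasible_coordinates_large hn hA hbd hx hpos
    set τ := 2 * n * (maxSubdet A : ℝ) with hτ
    have hτ2 : 2 ≤ τ := by nlinarith
    have hmem : (Fin.snoc (τ • y) τ : Fin (n + 1) → ℝ) ∈ feasibleSet es C d := by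
      refine ⟨?_, fun k => ?_⟩
      · rw [hes]
        intro i
        have h1 : (fun j => (A i j : ℝ)) ⬝ᵥ y = b i := congrFun hy.1 i
        rw [snoc_dotProduct]
        simp only [Fin.snoc_castSucc, Fin.snoc_last]
        change (fun j => (A i j : ℝ)) ⬝ᵥ (τ • y) + _ = 0
        rw [dotProduct_smul, h1, smul_eq_mul]
        ring
      · rw [hC, neg_unit_dotProduct, hd]
        refine Fin.lastCases ?_ (fun i => ?_) k
        · simpa using hτ2
        · have := hy1 i
          simp only [Fin.snoc_castSucc, Pi.smul_apply, smul_eq_mul]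
          linarith
    have h1 := hfar _ hmem
    have h2 : ‖WithLp.toLp 2 (Fin.snoc (τ • y) τ : Fin (n + 1) → ℝ)‖ ^ 2 < ρ ^ 2 := by
      rw [norm_snoc_sq, WithLp.toLp_smul, norm_smul, mul_pow, Real.norm_eq_abs, sq_abs,
        ← hrad]
      have h3 : ‖WithLp.toLp 2 y‖ ^ 2 < r ^ 2 := by
        have := hbd y hy
        gcongr
      have h4 : 0 < τ ^ 2 := by positivity
      nlinarith
    exact absurd (lt_of_pow_lt_pow_left₀ 2 hρ.le h2) (not_lt.mpr h1)
  rcases o with y | ⟨h, δ⟩ | _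
  · obtain ⟨hsol, hineq⟩ := ho
    rw [hes] at hsol
    have hlast : 1 < y (Fin.last n) := by
      have := hineq (Fin.last n)
      rw [hC, neg_unit_dotProduct, hd, Fin.snoc_last] at this
      linarith
    have hpos : ∀ i : Fin n, 0 ≤ y i.castSucc := fun i => by
      have := hineq i.castSucc
      rw [hC, neg_unit_dotProduct, hd, Fin.snoc_castSucc] at this
      linarith
    refine ⟨some fun i => y i.castSucc / y (Fin.last n), 14 + 2 * m + t + n,
      fun fuel hfuel => hlfs fuel hfuel _ _ ?_, ?_, by simp, hsteps⟩
    · simp only [run_bind, run_vec _ 1 fun i : Fin n =>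
        run_div (zero_lt_one.trans hlast).ne' (y i.castSucc), run_pure, Option.bind_some,
        Option.map_some, mul_one, add_zero]
    · rintro x hx
      rw [← Option.some.inj hx]
      exact homogenize_mem hsol hpos (zero_lt_one.trans hlast)
  · obtain ⟨hh, hy, hz⟩ := ho
    refine ⟨none, 14 + 2 * m + t + 0, fun fuel hfuel => hlfs fuel hfuel _ _ rfl, by simp,
      fun _ => hempty fun u hu => ?_, by omega⟩
    have h1 := hy u hu
    -- With center 0 the invariant gives `ρ ‖h‖ ≤ -δ ≤ -(h ⬝ᵥ u) ≤ ‖h‖ ‖u‖`.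
    have h2 := dotProduct_le_norm_mul h (-u)
    have h3 : h ⬝ᵥ (fun _ : Fin (n + 1) => (0 : ℝ)) = 0 := dotProduct_zero h
    rw [dotProduct_neg, WithLp.toLp_neg, norm_neg] at h2
    rw [h3] at hz
    have h4 := norm_toLp_pos hh
    have h5 : ρ * ‖WithLp.toLp 2 h‖ ≤ ‖WithLp.toLp 2 u‖ * ‖WithLp.toLp 2 h‖ := by linarith
    exact le_of_mul_le_mul_right h5 h4
  · refine ⟨none, 14 + 2 * m + t + 0, fun fuel hfuel => hlfs fuel hfuel _ _ rfl, by simp,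
      fun _ => hempty fun u hu => ?_, by omega⟩
    rw [show feasibleSet es C d = ∅ from ho] at hu
    exact hu.elim

end Chubanov

/-! ### The final estimate -/

theorem mainTheorem3 :
    ∃ c : ℝ, 0 < c ∧
      ∀ (m n : ℕ) (A : Matrix (Fin m) (Fin n) ℤ) (b : Fin m → ℤ) (r : ℝ),
        0 < n →
        (A.map (Int.cast : ℤ → ℝ)).rank = m →
        0 < r →
        (∀ x ∈ Chubanov.feasibleRegion A b, ‖WithLp.toLp 2 x‖ < r) →
        (Chubanov.feasibleRegion A b = ∅ ∨ ∃ x ∈ Chubanov.feasibleRegion A b, ∀ i, 0 < x i) →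
        ∃ (result : Option (Fin n → ℝ)) (time : ℕ),
          (∀ᶠ fuel in Filter.atTop,
            (Chubanov.lfs fuel (fun i j => (A i j : ℝ)) (fun i => (b i : ℝ))
              (Chubanov.maxSubdet A : ℝ) r).run = some (result, time)) ∧
          (∀ x, result = some x → x ∈ Chubanov.feasibleRegion A b) ∧
          (result = none → Chubanov.feasibleRegion A b = ∅) ∧
          (time : ℝ) ≤ c * ((m : ℝ) ^ 3 + (m : ℝ) ^ 2 * n + (n : ℝ) ^ 2 * m +
            (2 * n * (Chubanov.maxSubdet A : ℝ) * Real.sqrt (r ^ 2 + 1)) ^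
                (1 / Real.logb 2 (7 / 5)) *
              ((n : ℝ) ^ 2 +
                n * max 0 (Real.log (Chubanov.maxSubdet A) + Real.log r))) := by
  have hK : (1 : ℝ) ≤ 2 ^ (1 / Real.logb 2 (7 / 5)) :=
    Real.one_le_rpow (by norm_num)
      (div_nonneg zero_le_one (Real.logb_nonneg (by norm_num) (by norm_num)))
  set K : ℝ := 2 ^ (1 / Real.logb 2 (7 / 5)) with hKdef
  -- `330 K` is 165 from the step count times the factor `2 K` in the bound for `2 ^ N`; since `K ≥
  -- 1` it also covers the coefficients 12 and 5.
  refine ⟨330 * K, by positivity, fun m n A b r hn hA hr hbd hint => ?_⟩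
  have hρ : 1 ≤ 2 * n * (Chubanov.maxSubdet A : ℝ) * Real.sqrt (r ^ 2 + 1) := by
    have hn1 : (1 : ℝ) ≤ n := by exact_mod_cast hn
    have hΔ : (1 : ℝ) ≤ Chubanov.maxSubdet A := by exact_mod_cast Chubanov.one_le_maxSubdet hA
    have hs : 1 ≤ Real.sqrt (r ^ 2 + 1) := Real.one_le_sqrt.mpr (by nlinarith)
    exact one_le_mul_of_one_le_of_one_le
      (one_le_mul_of_one_le_of_one_le (by linarith) hΔ) hs
  obtain ⟨N, hN, h2N⟩ := Chubanov.exists_pow_depth hρ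
  obtain ⟨result, time, hrun, hsome, hnone, htime⟩ := Chubanov.run_lfs hn hA hbd hint N hN
  refine ⟨result, time, Filter.eventually_atTop.mpr ⟨N, hrun⟩, hsome, hnone, ?_⟩
  set R := (2 * n * (Chubanov.maxSubdet A : ℝ) * Real.sqrt (r ^ 2 + 1)) ^
    (1 / Real.logb 2 (7 / 5)) with hR
  set L := max 0 (Real.log (Chubanov.maxSubdet A) + Real.log r) with hL
  have hR0 : 0 ≤ R := Real.rpow_nonneg (by linarith) _
  have hL0 : 0 ≤ L := le_max_left _ _
  have h1 : (time : ℝ) ≤ 12 * ((m : ℝ) ^ 2 * n) + 5 * ((n : ℝ) ^ 2 * m) +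
      2 ^ N * (165 * (n : ℝ) ^ 2) := by exact_mod_cast htime
  have h2 : (2 : ℝ) ^ N * (165 * (n : ℝ) ^ 2) ≤ 330 * K * (R * (n : ℝ) ^ 2) := by
    calc _ ≤ 2 * K * R * (165 * (n : ℝ) ^ 2) := by gcongr
      _ = _ := by ring
  have h3 : 12 * ((m : ℝ) ^ 2 * n) ≤ 330 * K * ((m : ℝ) ^ 2 * n) := by gcongr; linarith
  have h4 : 5 * ((n : ℝ) ^ 2 * m) ≤ 330 * K * ((n : ℝ) ^ 2 * m) := by gcongr; linarith
  have h5 : 0 ≤ 330 * K * ((m : ℝ) ^ 3 + R * (n * L)) := by positivity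
  calc (time : ℝ) ≤ 330 * K * ((m : ℝ) ^ 2 * n) + 330 * K * ((n : ℝ) ^ 2 * m) +
        330 * K * (R * (n : ℝ) ^ 2) + 330 * K * ((m : ℝ) ^ 3 + R * (n * L)) := by linarith
    _ = _ := by ring
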